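/- Let $\mathbb{K}$ be an arbitrary field. For a tensor $T\in\mathbb{K}^{n_1}\otimes\mathbb{K}^{n_2}\otimes\mathbb{K}^{n_3}$, the subrank $\mathrm{Q}(T)$ is the largest integer $r$ for which there are linear maps $\pi_i:\mathbb{K}^{n_i}\to\mathbb{K}^r$ $(i=1,2,3)$ with $(\pi_1\otimes\pi_2\otimes\pi_3)T=\sum_{i=1}^r e_i\otimes e_i\otimes e_i$. Let $T^{\boxtimes N}\in\mathbb{K}^{n_1^N}\otimes\mathbb{K}^{n_2^N}\otimes\mathbb{K}^{n_3^N}$ be the $N$-th Kronecker power of $T$ (the $N$-fold tensor power of $T$, regrouped as a $3$-tensor via $(\mathbb{K}^{n_i})^{\otimes N}\cong\mathbb{K}^{n_i^N}$). Theorem. For every nonzero $T\in\mathbb{K}^{n_1}\otimes\mathbb{K}^{n_2}\otimes\mathbb{K}^{n_3}$, the limit $\tilde{\mathrm{Q}}(T):=\lim_{N\to\infty}\mathrm{Q}(T^{\boxtimes N})^{1/N}$ (the asymptotic subrank of $T$) exists, and exactly one of the following is true: (a) $\tilde{\mathrm{Q}}(T)=1$; (b) $\tilde{\mathrm{Q}}(T)=c_3$,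 where $c_3=3/2^{2/3}\approx 1.89$; (c) $\tilde{\mathrm{Q}}(T)\ge 2$. -/

import Mathlib

open scoped TensorProduct

/-- The space `K^a ⊗ K^b ⊗ K^c` of `3`-tensors over `K`. -/
abbrev Tensor3 (K : Type*) [Field K] (a b c : ℕ) : Type _ :=
  ((Fin a → K) ⊗[K] (Fin b → K)) ⊗[K] (Fin c → K)

namespace Tensor3

variable {K : Type*} [Field K]

/-- The unit tensor `∑ i, e_i ⊗ e_i ⊗ e_i` in `K^r ⊗ K^r ⊗ K^r`. -/
noncomputable def unit (K : Type*) [Field K] (r : ℕ) : Tensor3 K r r r :=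
  ∑ i : Fin r, ((Pi.single i (1 : K) : Fin r → K) ⊗ₜ[K] (Pi.single i (1 : K) : Fin r → K))
    ⊗ₜ[K] (Pi.single i (1 : K) : Fin r → K)

/-- `T` restricts to `S`: there are linear maps with `(π₁ ⊗ π₂ ⊗ π₃) T = S`. -/
def Restricts {a b c a' b' c' : ℕ} (T : Tensor3 K a b c) (S : Tensor3 K a' b' c') : Prop :=
  ∃ (π₁ : (Fin a → K) →ₗ[K] (Fin a' → K)) (π₂ : (Fin b → K) →ₗ[K] (Fin b' → K))
    (π₃ : (Fin c → K) →ₗ[K] (Fin c' → K)),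
    TensorProduct.map (TensorProduct.map π₁ π₂) π₃ T = S

/-- The subrank: the largest `r` such that `T` restricts to the unit tensor of rank `r`
(see `isGreatest_subrank`). -/
noncomputable def subrank {a b c : ℕ} (T : Tensor3 K a b c) : ℕ :=
  sSup {r : ℕ | Restricts T (unit K r)}

/-- The identification `K^n ⊗ K^m → K^(n m)`, sending `e_i ⊗ e_j` to the basis vector indexed by
the pair `(i, j)`. -/
noncomputable def merge (K : Type*) [Field K] (n m : ℕ) :
    (Fin n → K) ⊗[K] (Fin m → K) →ₗ[K] (Fin (n * m) → K) :=
  TensorProduct.lift (LinearMap.mk₂ K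
    (fun x y p => x (finProdFinEquiv.symm p).1 * y (finProdFinEquiv.symm p).2)
    (fun x x' y => by ext p; simp [add_mul])
    (fun t x y => by ext p; simp [mul_assoc])
    (fun x y y' => by ext p; simp [mul_add])
    (fun t x y => by ext p; simp [mul_left_comm]))

/-- The Kronecker product: regroup `T ⊗ S` as an element of
`(K^a ⊗ K^a') ⊗ (K^b ⊗ K^b') ⊗ (K^c ⊗ K^c')` and identify each factor. -/
noncomputable def kron {a b c a' b' c' : ℕ} (T : Tensor3 K a b c) (S : Tensor3 K a' b' c') :
    Tensor3 K (a * a') (b * b') (c * c') :=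
  TensorProduct.map (TensorProduct.map (merge K a a') (merge K b b')) (merge K c c')
    (TensorProduct.map
      (TensorProduct.tensorTensorTensorComm K (Fin a → K) (Fin b → K) (Fin a' → K)
        (Fin b' → K)).toLinearMap
      (LinearMap.id : (Fin c → K) ⊗[K] (Fin c' → K) →ₗ[K] (Fin c → K) ⊗[K] (Fin c' → K))
      (TensorProduct.tensorTensorTensorComm K ((Fin a → K) ⊗[K] (Fin b → K)) (Fin c → K)
        ((Fin a' → K) ⊗[K] (Fin b' → K)) (Fin c' → K) (T ⊗ₜ[K] S)))

/-- The Kronecker power `T^{⊠ N}` in `K^(a^N) ⊗ K^(b^N) ⊗ K^(c^N)`. -/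
noncomputable def kronPow {a b c : ℕ} (T : Tensor3 K a b c) :
    (N : ℕ) → Tensor3 K (a ^ N) (b ^ N) (c ^ N)
  | 0 => unit K 1
  | N + 1 => kron (kronPow T N) T

/-- The asymptotic subrank `lim_{N → ∞} Q(T^{⊠ N})^{1/N}`. -/
noncomputable def asymptoticSubrank {a b c : ℕ} (T : Tensor3 K a b c) : ℝ :=
  Filter.limUnder Filter.atTop (fun N : ℕ => (subrank (kronPow T N) : ℝ) ^ (1 / (N : ℝ)))

/-- On simple tensors the Kronecker product is taken factor by factor. -/
theorem kron_tmul {a b c a' b' c' : ℕ} (x : Fin a → K) (y : Fin b → K) (z : Fin c → K)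
    (x' : Fin a' → K) (y' : Fin b' → K) (z' : Fin c' → K) :
    kron ((x ⊗ₜ[K] y) ⊗ₜ[K] z) ((x' ⊗ₜ[K] y') ⊗ₜ[K] z') =
      ((fun p => x (finProdFinEquiv.symm p).1 * x' (finProdFinEquiv.symm p).2) ⊗ₜ[K]
        (fun p => y (finProdFinEquiv.symm p).1 * y' (finProdFinEquiv.symm p).2)) ⊗ₜ[K]
        (fun p => z (finProdFinEquiv.symm p).1 * z' (finProdFinEquiv.symm p).2) := by
  rfl

theorem le_of_restricts_unit {a b c r : ℕ} {T : Tensor3 K a b c} (h : Restricts T (unit K r)) :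
    r ≤ a := by
  obtain ⟨π₁, π₂, π₃, h⟩ := h
  have hsurj : ∀ i : Fin r, (Pi.single i (1 : K) : Fin r → K) ∈ LinearMap.range π₁ := by
    intro i
    let F : Tensor3 K r r r →ₗ[K] (Fin r → K) :=
      (TensorProduct.rid K (Fin r → K)).toLinearMap ∘ₗ
        TensorProduct.map ((TensorProduct.rid K (Fin r → K)).toLinearMap ∘ₗ
          TensorProduct.map LinearMap.id (LinearMap.proj i)) (LinearMap.proj i)
    have key : ∀ S : Tensor3 K a b c,
        F (TensorProduct.map (TensorProduct.map π₁ π₂) π₃ S) ∈ LinearMap.range π₁ := by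
      intro S
      induction S using TensorProduct.induction_on with
      | zero => rw [LinearMap.map_zero, LinearMap.map_zero]; exact zero_mem _
      | add s t hs ht => rw [map_add, map_add]; exact add_mem hs ht
      | tmul s z =>
        induction s using TensorProduct.induction_on with
        | zero =>
          rw [TensorProduct.zero_tmul, LinearMap.map_zero, LinearMap.map_zero]; exact zero_mem _
        | add s t hs ht =>
          rw [TensorProduct.add_tmul, map_add, map_add]; exact add_mem hs ht
        | tmul x y =>
          exact ⟨(π₃ z i) • (π₂ y i) • x, by simp [F]⟩
    have h2 := key T
    rw [h] at h2
    convert h2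
    simp [F, unit, Pi.single_apply]
  have htop : LinearMap.range π₁ = ⊤ := by
    rw [eq_top_iff, ← (Pi.basisFun K (Fin r)).span_eq, Submodule.span_le]
    rintro _ ⟨i, rfl⟩
    simpa using hsurj i
  simpa using LinearMap.finrank_le_finrank_of_surjective (LinearMap.range_eq_top.mp htop)

/-- The supremum in the definition of the subrank is a maximum. -/
theorem isGreatest_subrank {a b c : ℕ} (T : Tensor3 K a b c) :
    IsGreatest {r : ℕ | Restricts T (unit K r)} (subrank T) := by
  have hb : BddAbove {r : ℕ | Restricts T (unit K r)} := ⟨a, fun r hr => le_of_restricts_unit hr⟩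
  have hne : {r : ℕ | Restricts T (unit K r)}.Nonempty :=
    ⟨0, 0, 0, 0, by simp [unit]⟩
  exact ⟨Nat.sSup_mem hne hb, fun r hr => le_csSup hb hr⟩

end Tensor3

/-! The subrank is supermultiplicative along Kronecker powers, so Fekete's lemma gives the limit. To
find its value, make the trilinear form of `T` concise by discarding the kernels of its three
arguments. If some argument space then has dimension at most one, every power splits off a leg and
has subrank one. If the form contains the unit tensor of size two, the limit is at least 2. The
point is that little else remains: a concise form with all dimensions at least two and no such unit
tensor is `2 × 2 × 2` (`finrank_eq_two_of_not_hasUnitTwo`). Without the unit tensor, the rank one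
slices are so constrained that some hyperplane of an argument space keeps the form concise, over
every field (`exists_hyperplane_concise`). Iterating this down to a line produces a nondegenerate
slice, so the other two dimensions agree. By symmetry all three agree, and one further hyperplane
cut contradicts this unless they equal two.

A form of this kind is a pencil `(1, m)` with `m` nonscalar. Over the splitting field of the
characteristic polynomial, distinct eigenvalues yield the unit tensor, and a double eigenvalue
yields the `W`-tensor (`pencil_dichotomy`). Descending to `K` costs a bounded number of extra
Kronecker factors, because the square of the pencil contains a unit tensor over `K` itself
(`exists_shift_of_baseChange`); the limit does not see them.

For `W` the value is `c₃`, with `c₃ ^ 3 = 27 / 4`. The upper bound covers the support of a power by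
slices indexed by words of weight at most `N / 3` (`card_le_of_support_cover`, a slice rank
argument). The lower bound is Strassen's construction: hash the balanced support words into a
progression-free set of Behrend type and keep the isolated ones, which form a diagonal
(`exists_hash`, `wArr_pow_restricts_of_hash`). Since `1 < c₃ < 2`, the three cases exclude each
other. -/

/-! ### Restriction of coordinate arrays -/

/-- Restriction of coordinate arrays: `S` is obtained from `T` by three matrices. -/
def ArrRestricts {K α β γ α' β' γ' : Type*} [Field K] [Fintype α] [Fintype β] [Fintype γ]
    (T : α → β → γ → K) (S : α' → β' → γ' → K) : Prop :=
  ∃ (A : α' → α → K) (B : β' → β → K) (C : γ' → γ → K),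
    ∀ i j k, S i j k = ∑ x, ∑ y, ∑ z, A i x * B j y * C k z * T x y z

/-- The unit array. -/
def arrUnit (K ι : Type*) [Field K] [DecidableEq ι] (i j k : ι) : K :=
  if i = j ∧ j = k then 1 else 0

/-- The Kronecker product of arrays. -/
def arrKron {K α β γ α' β' γ' : Type*} [Field K] (T : α → β → γ → K) (S : α' → β' → γ' → K)
    (i : α × α') (j : β × β') (k : γ × γ') : K :=
  T i.1 j.1 k.1 * S i.2 j.2 k.2

/-- The Kronecker power of an array. -/
def arrPow {K α β γ : Type*} [Field K] (T : α → β → γ → K) (N : ℕ)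
    (i : Fin N → α) (j : Fin N → β) (k : Fin N → γ) : K :=
  ∏ t, T (i t) (j t) (k t)

theorem sum_triple {M α β γ : Type*} [AddCommMonoid M] [Fintype α] [Fintype β] [Fintype γ]
    (f : α → β → γ → M) :
    ∑ x, ∑ y, ∑ z, f x y z = ∑ p : α × β × γ, f p.1 p.2.1 p.2.2 := by
  simp [Fintype.sum_prod_type]

theorem sum_mul_sum_mul_sum {K α β γ : Type*} [Field K] [Fintype α] [Fintype β] [Fintype γ]
    (f : α → K) (g : β → K) (h : γ → K) :
    (∑ x, f x) * (∑ y, g y) * ∑ z, h z = ∑ p : α × β × γ, f p.1 * g p.2.1 * h p.2.2 := by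
  rw [Fintype.sum_prod_type, Finset.sum_mul_sum, Finset.sum_mul]
  refine Finset.sum_congr rfl fun x _ => ?_
  rw [Fintype.sum_prod_type, Finset.sum_mul]
  refine Finset.sum_congr rfl fun y _ => ?_
  rw [Finset.mul_sum]

namespace ArrRestricts

variable {K : Type*} [Field K]
variable {α β γ α' β' γ' α'' β'' γ'' δ ε ζ δ' ε' ζ' : Type*}
  [Fintype α] [Fintype β] [Fintype γ] [Fintype α'] [Fintype β'] [Fintype γ']
  [Fintype δ] [Fintype ε] [Fintype ζ]

theorem reindex (T : α → β → γ → K) (f : α'' → α) (g : β'' → β) (h : γ'' → γ) :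
    ArrRestricts T (fun i j k => T (f i) (g j) (h k)) := by
  classical
  refine ⟨fun i x => if x = f i then 1 else 0, fun i x => if x = g i then 1 else 0,
    fun i x => if x = h i then 1 else 0, fun i j k => ?_⟩
  simp [Finset.sum_ite_eq', ite_mul, mul_ite]

theorem of_eq {T : α → β → γ → K} {S : α'' → β'' → γ'' → K} (f : α'' → α) (g : β'' → β)
    (h : γ'' → γ) (H : ∀ i j k, S i j k = T (f i) (g j) (h k)) : ArrRestricts T S := by
  rw [show S = fun i j k => T (f i) (g j) (h k) by ext i j k; exact H i j k]
  exact reindex T f g h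

theorem refl (T : α → β → γ → K) : ArrRestricts T T := reindex T id id id

theorem trans {T : α → β → γ → K} {S : α' → β' → γ' → K} {U : α'' → β'' → γ'' → K}
    (h₁ : ArrRestricts T S) (h₂ : ArrRestricts S U) : ArrRestricts T U := by
  obtain ⟨A, B, C, h⟩ := h₁
  obtain ⟨A', B', C', h'⟩ := h₂
  refine ⟨fun i x => ∑ u, A' i u * A u x, fun j y => ∑ v, B' j v * B v y,
    fun k z => ∑ w, C' k w * C w z, fun i j k => ?_⟩
  rw [h' i j k]
  simp_rw [h]
  simp only [sum_triple]
  conv_lhs => simp only [Finset.mul_sum]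
  rw [Finset.sum_comm]
  refine Finset.sum_congr rfl fun p _ => ?_
  rw [sum_mul_sum_mul_sum, Finset.sum_mul]
  refine Finset.sum_congr rfl fun q _ => by ring

theorem kron {T : α → β → γ → K} {S : δ → ε → ζ → K} {T' : α'' → β'' → γ'' → K}
    {S' : δ' → ε' → ζ' → K} (h₁ : ArrRestricts T T') (h₂ : ArrRestricts S S') :
    ArrRestricts (arrKron T S) (arrKron T' S') := by
  obtain ⟨A, B, C, h⟩ := h₁
  obtain ⟨A', B', C', h'⟩ := h₂
  refine ⟨fun i x => A i.1 x.1 * A' i.2 x.2, fun i x => B i.1 x.1 * B' i.2 x.2,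
    fun i x => C i.1 x.1 * C' i.2 x.2, fun i j k => ?_⟩
  simp only [arrKron, h, h', sum_triple]
  rw [Finset.sum_mul_sum, ← Fintype.sum_prod_type']
  refine Fintype.sum_equiv ⟨fun p => ((p.1.1, p.2.1), (p.1.2.1, p.2.2.1), (p.1.2.2, p.2.2.2)),
    fun p => ((p.1.1, p.2.1.1, p.2.2.1), (p.1.2, p.2.1.2, p.2.2.2)), fun _ => rfl,
    fun _ => rfl⟩ _ _ fun p => ?_
  simp only [Equiv.coe_fn_mk]
  ring

theorem pow {T : α → β → γ → K} {T' : α'' → β'' → γ'' → K}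
    (h₁ : ArrRestricts T T') (N : ℕ) :
    ArrRestricts (arrPow T N) (arrPow T' N) := by
  classical
  obtain ⟨A, B, C, h⟩ := h₁
  refine ⟨fun i x => ∏ t, A (i t) (x t), fun i x => ∏ t, B (i t) (x t),
    fun i x => ∏ t, C (i t) (x t), fun i j k => ?_⟩
  simp only [arrPow, h, Finset.prod_univ_sum, Fintype.piFinset_univ, Finset.prod_mul_distrib]

end ArrRestricts

/-! ### Tensors in coordinates -/

namespace Tensor3

variable {K : Type*} [Field K]

/-- The basis of `K^a ⊗ K^b ⊗ K^c` made of the `e_i ⊗ e_j ⊗ e_k`. -/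
noncomputable def stdBasis (K : Type*) [Field K] (a b c : ℕ) :
    Module.Basis ((Fin a × Fin b) × Fin c) K (Tensor3 K a b c) :=
  ((Pi.basisFun K (Fin a)).tensorProduct (Pi.basisFun K (Fin b))).tensorProduct
    (Pi.basisFun K (Fin c))

/-- The coordinate array of a tensor. -/
noncomputable def arr {a b c : ℕ} (T : Tensor3 K a b c) (i : Fin a) (j : Fin b) (k : Fin c) : K :=
  (stdBasis K a b c).repr T ((i, j), k)

theorem arr_tmul {a b c : ℕ} (x : Fin a → K) (y : Fin b → K) (z : Fin c → K) (i j k) :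
    arr ((x ⊗ₜ[K] y) ⊗ₜ[K] z) i j k = x i * y j * z k := by
  simp [arr, stdBasis, Module.Basis.tensorProduct_repr_tmul_apply, mul_comm, mul_left_comm]

theorem arr_add {a b c : ℕ} (S T : Tensor3 K a b c) (i j k) :
    arr (S + T) i j k = arr S i j k + arr T i j k := by simp [arr]

theorem arr_zero {a b c : ℕ} (i j k) : arr (0 : Tensor3 K a b c) i j k = 0 := by
  rw [arr, LinearEquiv.map_zero]; rfl

theorem arr_sum {a b c : ℕ} {ι : Type*} (s : Finset ι) (T : ι → Tensor3 K a b c) (i j k) :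
    arr (∑ u ∈ s, T u) i j k = ∑ u ∈ s, arr (T u) i j k := by simp [arr]

theorem arr_injective {a b c : ℕ} {S T : Tensor3 K a b c}
    (h : ∀ i j k, arr S i j k = arr T i j k) : S = T :=
  (stdBasis K a b c).repr.injective (Finsupp.ext fun p => h p.1.1 p.1.2 p.2)

@[elab_as_elim]
theorem induction {a b c : ℕ} {P : Tensor3 K a b c → Prop} (T : Tensor3 K a b c) (h0 : P 0)
    (h1 : ∀ x y z, P ((x ⊗ₜ[K] y) ⊗ₜ[K] z)) (h2 : ∀ S T, P S → P T → P (S + T)) : P T := by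
  induction T using TensorProduct.induction_on with
  | zero => exact h0
  | add s t hs ht => exact h2 _ _ hs ht
  | tmul s z =>
    induction s using TensorProduct.induction_on with
    | zero => rw [TensorProduct.zero_tmul]; exact h0
    | add s t hs ht => rw [TensorProduct.add_tmul]; exact h2 _ _ hs ht
    | tmul x y => exact h1 x y z

theorem arr_unit (r : ℕ) : arr (unit K r) = arrUnit K (Fin r) := by
  ext i j k
  rw [unit, arr_sum]
  simp_rw [arr_tmul, Pi.single_apply]
  rw [Finset.sum_eq_single i]
  · simp [arrUnit, eq_comm, ite_and]
    grind
  · intro b _ hb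
    simp [hb.symm]
  · simp

theorem arr_map {a b c a' b' c' : ℕ} (T : Tensor3 K a b c)
    (π₁ : (Fin a → K) →ₗ[K] (Fin a' → K)) (π₂ : (Fin b → K) →ₗ[K] (Fin b' → K))
    (π₃ : (Fin c → K) →ₗ[K] (Fin c' → K)) (i j k) :
    arr (TensorProduct.map (TensorProduct.map π₁ π₂) π₃ T) i j k =
      ∑ x, ∑ y, ∑ z, π₁ (Pi.single x 1) i * π₂ (Pi.single y 1) j * π₃ (Pi.single z 1) k *
        arr T x y z := by
  induction T using Tensor3.induction with
  | h0 => rw [LinearMap.map_zero]; simp [arr_zero]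
  | h2 S T hS hT =>
    rw [LinearMap.map_add]
    simp [arr_add, hS, hT, mul_add, Finset.sum_add_distrib]
  | h1 u v w =>
    have key : ∀ {m n : ℕ} (π : (Fin m → K) →ₗ[K] (Fin n → K)) (u : Fin m → K) (i : Fin n),
        π u i = ∑ x, π (Pi.single x 1) i * u x := by
      intro m n π u i
      conv_lhs => rw [pi_eq_sum_univ' u]
      simp [Finset.sum_apply, mul_comm]
    simp only [TensorProduct.map_tmul, arr_tmul]
    rw [key π₁ u, key π₂ v, key π₃ w]
    rw [sum_mul_sum_mul_sum, sum_triple]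
    refine Finset.sum_congr rfl fun u _ => by ring

theorem restricts_iff {a b c a' b' c' : ℕ} (T : Tensor3 K a b c) (S : Tensor3 K a' b' c') :
    Restricts T S ↔ ArrRestricts (arr T) (arr S) := by
  constructor
  · rintro ⟨π₁, π₂, π₃, rfl⟩
    exact ⟨fun i x => π₁ (Pi.single x 1) i, fun i x => π₂ (Pi.single x 1) i,
      fun i x => π₃ (Pi.single x 1) i, fun i j k => arr_map ..⟩
  · rintro ⟨A, B, C, h⟩
    refine ⟨Matrix.mulVecLin (Matrix.of A), Matrix.mulVecLin (Matrix.of B),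
      Matrix.mulVecLin (Matrix.of C), arr_injective fun i j k => ?_⟩
    rw [arr_map, h]
    simp

theorem arr_kron {a b c a' b' c' : ℕ} (T : Tensor3 K a b c) (S : Tensor3 K a' b' c') (i j k) :
    arr (kron T S) i j k = arrKron (arr T) (arr S) (finProdFinEquiv.symm i)
      (finProdFinEquiv.symm j) (finProdFinEquiv.symm k) := by
  have hadd : ∀ (T T' : Tensor3 K a b c) (S : Tensor3 K a' b' c'),
      kron (T + T') S = kron T S + kron T' S := fun T T' S => by
    simp only [kron, TensorProduct.add_tmul, map_add]
  have hadd' : ∀ (T : Tensor3 K a b c) (S S' : Tensor3 K a' b' c'),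
      kron T (S + S') = kron T S + kron T S' := fun T T' S => by
    simp only [kron, TensorProduct.tmul_add, map_add]
  have h0 : ∀ (S : Tensor3 K a' b' c'), kron (0 : Tensor3 K a b c) S = 0 := fun S => by
    simp only [kron, TensorProduct.zero_tmul, map_zero]
  have h0' : ∀ (T : Tensor3 K a b c), kron T (0 : Tensor3 K a' b' c') = 0 := fun S => by
    simp only [kron, TensorProduct.tmul_zero, map_zero]
  induction T using Tensor3.induction with
  | h0 => simp [arrKron, h0, arr_zero]
  | h2 T T' hT hT' => rw [hadd, arr_add, hT, hT']; simp [arrKron, arr_add, add_mul]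
  | h1 x y z =>
    induction S using Tensor3.induction with
    | h0 => simp [arrKron, h0', arr_zero]
    | h2 T T' hT hT' => rw [hadd', arr_add, hT, hT']; simp [arrKron, arr_add, mul_add]
    | h1 x' y' z' =>
      rw [kron_tmul]
      simp only [arrKron, arr_tmul]
      ring

end Tensor3

/-! ### Kronecker powers and the subrank in coordinates -/

theorem arrPow_add {K α β γ : Type*} [Field K] [Fintype α] [Fintype β] [Fintype γ]
    (T : α → β → γ → K) (N M : ℕ) :
    ArrRestricts (arrPow T (N + M)) (arrKron (arrPow T N) (arrPow T M)) := by
  refine ArrRestricts.of_eq (fun i : (Fin N → α) × (Fin M → α) =>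
    Fin.append i.1 i.2) (fun i : (Fin N → β) × (Fin M → β) => Fin.append i.1 i.2)
    (fun i : (Fin N → γ) × (Fin M → γ) => Fin.append i.1 i.2) fun i j k => ?_
  simp [arrKron, arrPow, Fin.prod_univ_add]

theorem arrKron_arrPow {K α β γ : Type*} [Field K] [Fintype α] [Fintype β] [Fintype γ]
    (T : α → β → γ → K) (N M : ℕ) :
    ArrRestricts (arrKron (arrPow T N) (arrPow T M)) (arrPow T (N + M)) := by
  refine ArrRestricts.of_eq
    (fun i : Fin (N + M) → α => (fun s => i (Fin.castAdd M s), fun s => i (Fin.natAdd N s)))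
    (fun i : Fin (N + M) → β => (fun s => i (Fin.castAdd M s), fun s => i (Fin.natAdd N s)))
    (fun i : Fin (N + M) → γ => (fun s => i (Fin.castAdd M s), fun s => i (Fin.natAdd N s)))
    fun i j k => ?_
  simp [arrKron, arrPow, Fin.prod_univ_add]

theorem arrPow_one {K α β γ : Type*} [Field K] [Fintype α] [Fintype β] [Fintype γ]
    (T : α → β → γ → K) : ArrRestricts (arrPow T 1) T := by
  refine ArrRestricts.of_eq (fun i _ => i) (fun i _ => i) (fun i _ => i) fun i j k => ?_
  simp [arrPow]

theorem restricts_arrPow_one {K α β γ : Type*} [Field K] [Fintype α] [Fintype β] [Fintype γ]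
    (T : α → β → γ → K) : ArrRestricts T (arrPow T 1) := by
  refine ArrRestricts.of_eq (fun i : Fin 1 → α => i 0) (fun i : Fin 1 → β => i 0)
    (fun i : Fin 1 → γ => i 0) fun i j k => ?_
  simp [arrPow]

namespace Tensor3

variable {K : Type*} [Field K]

/-- The two sides differ only in how the indices are encoded. Mutual restriction is enough, since
the subrank depends only on what a tensor restricts to. -/
theorem arr_kronPow {a b c : ℕ} (T : Tensor3 K a b c) (N : ℕ) :
    ArrRestricts (arr (kronPow T N)) (arrPow (arr T) N) ∧
      ArrRestricts (arrPow (arr T) N) (arr (kronPow T N)) := by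
  induction N with
  | zero =>
    constructor
    · refine ArrRestricts.of_eq (T := arr (unit K 1)) (fun _ => 0) (fun _ => 0) (fun _ => 0)
        fun i j k => ?_
      rw [arr_unit]
      simp [arrUnit, arrPow]
    · refine ArrRestricts.of_eq (S := arr (unit K 1)) (fun _ => Fin.elim0) (fun _ => Fin.elim0)
        (fun _ => Fin.elim0) fun i j k => ?_
      rw [arr_unit]
      simp [arrUnit, arrPow, Subsingleton.elim i j, Subsingleton.elim j k]
  | succ N ih =>
    constructor
    · refine ArrRestricts.trans (S := arrKron (arr (kronPow T N)) (arr T)) ?_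
        ((ArrRestricts.kron ih.1 (restricts_arrPow_one _)).trans (arrKron_arrPow _ N 1))
      refine ArrRestricts.of_eq (T := arr (kron (kronPow T N) T)) finProdFinEquiv finProdFinEquiv
        finProdFinEquiv fun i j k => ?_
      simp [arr_kron]
    · refine (((arrPow_add _ N 1)).trans (ArrRestricts.kron ih.2 (arrPow_one _))).trans ?_
      refine ArrRestricts.of_eq finProdFinEquiv.symm
        finProdFinEquiv.symm finProdFinEquiv.symm fun i j k => ?_
      exact arr_kron (kronPow T N) T i j k

theorem le_subrank_iff {a b c : ℕ} (T : Tensor3 K a b c) (r N : ℕ) :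
    r ≤ subrank (kronPow T N) ↔ ArrRestricts (arrPow (arr T) N) (arrUnit K (Fin r)) := by
  have key : ∀ r, Restricts (kronPow T N) (unit K r) ↔
      ArrRestricts (arrPow (arr T) N) (arrUnit K (Fin r)) := fun r => by
    rw [restricts_iff, arr_unit]
    exact ⟨(arr_kronPow T N).2.trans, (arr_kronPow T N).1.trans⟩
  obtain ⟨h1, h2⟩ := isGreatest_subrank (kronPow T N)
  rw [← key]
  refine ⟨fun h => ?_, fun h => h2 h⟩
  rw [key]
  refine ((key _).1 h1).trans ?_
  refine ArrRestricts.of_eq (Fin.castLE h)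
    (Fin.castLE h) (Fin.castLE h) fun i j k => ?_
  simp [arrUnit]

end Tensor3

/-! ### Existence of the limit -/

-- Fekete's lemma for the subadditive sequence `-log (Q N)`; the exponential bound on `Q` keeps its
-- averages bounded below.
open Filter Topology in
theorem tendsto_rpow_inv_of_supermultiplicative {Q : ℕ → ℕ} {a : ℕ} (h1 : ∀ N, 1 ≤ Q N)
    (hm : ∀ N M, Q N * Q M ≤ Q (N + M)) (hb : ∀ N, Q N ≤ a ^ N) :
    ∃ L : ℝ, 0 < L ∧ Tendsto (fun N : ℕ => (Q N : ℝ) ^ (1 / (N : ℝ))) atTop (𝓝 L) := by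
  have hpos : ∀ N, (0 : ℝ) < Q N := fun N => by exact_mod_cast h1 N
  have hsub : Subadditive (fun N => - Real.log (Q N)) := fun N M => by
    have : Real.log (Q N * Q M) ≤ Real.log (Q (N + M)) :=
      Real.log_le_log (mul_pos (hpos N) (hpos M)) (by exact_mod_cast hm N M)
    rw [Real.log_mul (hpos N).ne' (hpos M).ne'] at this
    linarith
  have hbdd : BddBelow (Set.range fun N : ℕ => - Real.log (Q N) / N) := by
    refine ⟨- Real.log a, ?_⟩
    rintro _ ⟨N, rfl⟩
    rcases Nat.eq_zero_or_pos N with rfl | hN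
    · simp [Real.log_natCast_nonneg]
    · have : Real.log (Q N) ≤ N * Real.log a := by
        rw [← Real.log_pow]
        exact Real.log_le_log (hpos N) (by exact_mod_cast hb N)
      have hN' : (0 : ℝ) < N := by exact_mod_cast hN
      change - Real.log a ≤ - Real.log (Q N) / N
      rw [le_div_iff₀ hN']
      linarith
  refine ⟨Real.exp (- hsub.lim), Real.exp_pos _, ?_⟩
  refine ((Real.continuous_exp.tendsto _).comp (hsub.tendsto_lim hbdd).neg).congr fun N => ?_
  rw [Real.rpow_def_of_pos (hpos N)]
  simp only [Function.comp]
  congr 1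
  ring

namespace Tensor3

variable {K : Type*} [Field K]

theorem subrank_kronPow_mul_le {a b c : ℕ} (T : Tensor3 K a b c) (N M : ℕ) :
    subrank (kronPow T N) * subrank (kronPow T M) ≤ subrank (kronPow T (N + M)) := by
  rw [le_subrank_iff]
  refine (arrPow_add _ N M).trans ((ArrRestricts.kron ((le_subrank_iff T _ N).1 le_rfl)
    ((le_subrank_iff T _ M).1 le_rfl)).trans ?_)
  refine ArrRestricts.of_eq finProdFinEquiv.symm finProdFinEquiv.symm finProdFinEquiv.symm
    fun i j k => ?_
  have : ∀ {i j : Fin (subrank (kronPow T N) * subrank (kronPow T M))}, i = j ↔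
      (finProdFinEquiv.symm i).1 = (finProdFinEquiv.symm j).1 ∧
      (finProdFinEquiv.symm i).2 = (finProdFinEquiv.symm j).2 := by
    intro i j
    rw [← finProdFinEquiv.symm.injective.eq_iff, Prod.ext_iff]
  simp only [arrKron, arrUnit, this (i := i), this (i := j)]
  split_ifs <;> simp_all

theorem one_le_subrank_kronPow {a b c : ℕ} {T : Tensor3 K a b c} (hT : T ≠ 0) (N : ℕ) :
    1 ≤ subrank (kronPow T N) := by
  rw [le_subrank_iff]
  obtain ⟨i, j, k, h⟩ : ∃ i j k, arr T i j k ≠ 0 := by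
    by_contra! h
    exact hT (arr_injective fun i j k => by rw [h, arr_zero])
  refine (ArrRestricts.pow (T' := arrUnit K (Fin 1)) ?_ N).trans ?_
  · classical
    refine ⟨fun _ x => if x = i then (arr T i j k)⁻¹ else 0, fun _ x => if x = j then 1 else 0,
      fun _ x => if x = k then 1 else 0, fun u v w => ?_⟩
    simp [arrUnit, Subsingleton.elim u v, Subsingleton.elim v w, ite_mul, mul_ite, h]
  · refine ArrRestricts.of_eq (fun _ _ => 0) (fun _ _ => 0) (fun _ _ => 0) fun u v w => ?_
    simp [arrUnit, arrPow, Subsingleton.elim u v, Subsingleton.elim v w]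

theorem exists_tendsto_subrank {a b c : ℕ} {T : Tensor3 K a b c} (hT : T ≠ 0) :
    ∃ L : ℝ, 0 < L ∧ Filter.Tendsto
      (fun N : ℕ => (subrank (kronPow T N) : ℝ) ^ (1 / (N : ℝ))) Filter.atTop (nhds L) :=
  tendsto_rpow_inv_of_supermultiplicative (one_le_subrank_kronPow hT) (subrank_kronPow_mul_le T)
    fun _ => le_of_restricts_unit (isGreatest_subrank _).1

end Tensor3
-- Trilinear forms, functionals and subspaces
open Module

/-- A trilinear form is concise if it has no kernel in any of its three arguments. -/
structure Concise {K A B C : Type*} [Field K] [AddCommGroup A] [Module K A] [AddCommGroup B]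
    [Module K B] [AddCommGroup C] [Module K C] (T : A →ₗ[K] B →ₗ[K] C →ₗ[K] K) : Prop where
  fst : ∀ a, (∀ b c, T a b c = 0) → a = 0
  snd : ∀ b, (∀ a c, T a b c = 0) → b = 0
  thd : ∀ c, (∀ a b, T a b c = 0) → c = 0

/-- A trilinear form contains the unit tensor of size two. -/
def HasUnitTwo {K A B C : Type*} [Field K] [AddCommGroup A] [Module K A] [AddCommGroup B]
    [Module K B] [AddCommGroup C] [Module K C] (T : A →ₗ[K] B →ₗ[K] C →ₗ[K] K) : Prop :=
  ∃ (a : Fin 2 → A) (b : Fin 2 → B) (c : Fin 2 → C),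
    ∀ i j k, T (a i) (b j) (c k) = arrUnit K (Fin 2) i j k

section Dual

variable {K A : Type*} [Field K] [AddCommGroup A] [Module K A]

/-- A functional that vanishes on the kernel of `η` is a multiple of `η`. -/
theorem exists_eq_one_of_not_smul {ξ η : Dual K A} (h : ∀ t : K, ξ ≠ t • η) :
    ∃ a, ξ a = 1 ∧ η a = 0 := by
  suffices H : ∃ a, ξ a ≠ 0 ∧ η a = 0 by
    obtain ⟨a, h1, h2⟩ := H
    exact ⟨(ξ a)⁻¹ • a, by simp [h1], by simp [h2]⟩
  by_contra! hcon
  by_cases hη : η = 0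
  · refine h 0 (LinearMap.ext fun a => ?_)
    by_contra h'
    exact hcon a (by simpa using h') (by simp [hη])
  obtain ⟨u, hu⟩ : ∃ u, η u ≠ 0 := by
    by_contra! h'
    exact hη (LinearMap.ext h')
  refine h (ξ u * (η u)⁻¹) (LinearMap.ext fun a => ?_)
  have h0 : ξ (a - (η a * (η u)⁻¹) • u) = 0 := by
    by_contra h'
    exact hcon _ h' (by simp [hu])
  simp only [map_sub, map_smul, smul_eq_mul] at h0
  simp only [LinearMap.smul_apply, smul_eq_mul]
  linear_combination h0

theorem exists_dual_pair {ξ η : Dual K A} (h : LinearIndependent K ![ξ, η]) :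
    ∃ a b : A, ξ a = 1 ∧ ξ b = 0 ∧ η a = 0 ∧ η b = 1 := by
  have hη : η ≠ 0 := by simpa using h.ne_zero 1
  have hξ : ξ ≠ 0 := by simpa using h.ne_zero 0
  obtain ⟨b, h1, h2⟩ := exists_eq_one_of_not_smul (ξ := η) (η := ξ) fun t ht =>
    (LinearIndependent.pair_iff' hξ).1 h t ht.symm
  obtain ⟨a, h3, h4⟩ := exists_eq_one_of_not_smul (ξ := ξ) (η := η) fun t ht =>
    (LinearIndependent.pair_iff' hη).1 (LinearIndependent.pair_symm_iff.1 h) t ht.symm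
  exact ⟨a, b, h3, h2, h4, h1⟩

theorem exists_linearIndependent_of_two_le_finrank {V : Type*} [AddCommGroup V] [Module K V]
    (h : 2 ≤ finrank K V) {x : V} (hx : x ≠ 0) :
    ∃ y, LinearIndependent K ![x, y] := by
  by_contra! hcon
  have htop : (K ∙ x) = ⊤ := by
    refine eq_top_iff.2 fun y _ => Submodule.mem_span_singleton.2 ?_
    by_contra! hy
    exact hcon y ((LinearIndependent.pair_iff' hx).2 hy)
  have := finrank_span_singleton (K := K) hx
  rw [htop, finrank_top] at this
  omega

/-- This holds over every field, even with two elements, where three proper subspaces can already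
cover a plane. The hyperplane argument has only two subspaces to avoid. -/
theorem exists_notMem_union {V : Type*} [AddCommGroup V] [Module K V] {U W : Submodule K V}
    (hU : U ≠ ⊤) (hW : W ≠ ⊤) : ∃ x, x ∉ U ∧ x ∉ W := by
  obtain ⟨u, hu⟩ : ∃ u, u ∉ U := by by_contra! h; exact hU (eq_top_iff.2 fun x _ => h x)
  obtain ⟨w, hw⟩ : ∃ w, w ∉ W := by by_contra! h; exact hW (eq_top_iff.2 fun x _ => h x)
  by_cases h1 : u ∈ W
  · by_cases h2 : w ∈ U
    · refine ⟨u + w, fun h => hu ?_, fun h => hw ?_⟩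
      · simpa using U.sub_mem h h2
      · simpa using W.sub_mem h h1
    · exact ⟨w, h2, hw⟩
  · exact ⟨u, hu, h1⟩

end Dual

/-! ### Rank one slices and concise hyperplane restrictions -/

section Trilinear

variable {K A B C : Type*} [Field K] [AddCommGroup A] [Module K A] [AddCommGroup B]
    [Module K B] [AddCommGroup C] [Module K C] {T : A →ₗ[K] B →ₗ[K] C →ₗ[K] K}

theorem hasUnitTwo_of_vecs {a₀ a₁ : A} {b₀ b₁ : B} {c₀ c₁ : C}
    (h000 : T a₀ b₀ c₀ = 1) (h001 : T a₀ b₀ c₁ = 0) (h010 : T a₀ b₁ c₀ = 0)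
    (h011 : T a₀ b₁ c₁ = 0) (h100 : T a₁ b₀ c₀ = 0) (h101 : T a₁ b₀ c₁ = 0)
    (h110 : T a₁ b₁ c₀ = 0) (h111 : T a₁ b₁ c₁ = 1) : HasUnitTwo T := by
  refine ⟨![a₀, a₁], ![b₀, b₁], ![c₀, c₁], fun i j k => ?_⟩
  fin_cases i <;> fin_cases j <;> fin_cases k <;> simp [arrUnit, *]

theorem hasUnitTwo_of_rank_one_pair {b₀ b₁ : B} {ξ₀ ξ₁ : Dual K A} {η₀ η₁ : Dual K C}
    (h₀ : ∀ a c, T a b₀ c = ξ₀ a * η₀ c) (h₁ : ∀ a c, T a b₁ c = ξ₁ a * η₁ c)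
    (hξ : LinearIndependent K ![ξ₀, ξ₁]) (hη : LinearIndependent K ![η₀, η₁]) :
    HasUnitTwo T := by
  obtain ⟨a₀, a₁, h1, h2, h3, h4⟩ := exists_dual_pair hξ
  obtain ⟨c₀, c₁, k1, k2, k3, k4⟩ := exists_dual_pair hη
  apply hasUnitTwo_of_vecs (T := T) (a₀ := a₀) (a₁ := a₁) (b₀ := b₀) (b₁ := b₁) (c₀ := c₀)
    (c₁ := c₁) <;> simp [*]

/-- The functionals `ξ` such that `ξ ⊗ η` is a slice of `T`. -/
def sliceFunctionals (T : A →ₗ[K] B →ₗ[K] C →ₗ[K] K) (η : Dual K C) :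
    Submodule K (Dual K A) where
  carrier := {ξ | ∃ b, ∀ a c, T a b c = ξ a * η c}
  zero_mem' := ⟨0, by simp⟩
  add_mem' := by
    rintro ξ ξ' ⟨b, hb⟩ ⟨b', hb'⟩
    exact ⟨b + b', fun a c => by simp [hb, hb', add_mul]⟩
  smul_mem' := by
    rintro t ξ ⟨b, hb⟩
    exact ⟨t • b, fun a c => by simp [hb, mul_assoc]⟩

/-- There are enough slices of the form `ξ ⊗ η` to repair any other slice. Take `c₀` in the kernel
of `η` and a slice through `b₀` that does not vanish at `c₀`. Subtracting a slice `ξ' ⊗ η` clears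
its values at `c₁` without touching those at `c₀`, and another slice `ξ ⊗ η` supplies the second
diagonal entry. -/
theorem hasUnitTwo_of_sliceFunctionals_eq_top [FiniteDimensional K A] [FiniteDimensional K C]
    (hT : Concise T) (hA : 2 ≤ finrank K A) (hC : 2 ≤ finrank K C) {η : Dual K C} (hη : η ≠ 0)
    (h : sliceFunctionals T η = ⊤) : HasUnitTwo T := by
  have hS : ∀ ξ : Dual K A, ∃ b, ∀ a c, T a b c = ξ a * η c := fun ξ => by
    have : ξ ∈ sliceFunctionals T η := h ▸ Submodule.mem_top
    exact this
  obtain ⟨θ, hθ⟩ := exists_linearIndependent_of_two_le_finrank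
    (by rwa [Subspace.dual_finrank_eq]) hη
  obtain ⟨c₁, c₀, e1, e2, -, e4⟩ := exists_dual_pair hθ
  have hc₀ : c₀ ≠ 0 := by rintro rfl; simp at e4
  obtain ⟨a₀, b₀, h0⟩ : ∃ a b, T a b c₀ ≠ 0 := by
    by_contra! h0
    exact hc₀ (hT.thd _ h0)
  set m : Dual K A := (T.flip b₀).flip c₀ with hm
  have hm0 : m ≠ 0 := fun h' => h0 (by simpa [hm] using congrArg (· a₀) h')
  obtain ⟨ξ, hξ⟩ := exists_linearIndependent_of_two_le_finrank
    (by rwa [Subspace.dual_finrank_eq]) hm0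
  obtain ⟨b₁, hb₁⟩ := hS ξ
  obtain ⟨b', hb'⟩ := hS ((T.flip b₀).flip c₁)
  obtain ⟨x, y, f1, f2, f3, f4⟩ := exists_dual_pair hξ
  simp only [hm, LinearMap.flip_apply] at f1 f2 hb'
  apply hasUnitTwo_of_vecs (T := T) (a₀ := x) (a₁ := y) (b₀ := b₀ - b') (b₁ := b₁) (c₀ := c₀)
    (c₁ := c₁) <;> simp [*]

/-- The nonzero functionals `ξ` occurring in rank one slices all lie in a proper subspace. -/
theorem exists_proper_of_not_hasUnitTwo [FiniteDimensional K A] [FiniteDimensional K C]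
    (hT : Concise T) (hA : 2 ≤ finrank K A) (hC : 2 ≤ finrank K C) (h : ¬ HasUnitTwo T) :
    ∃ U : Submodule K (Dual K A), U ≠ ⊤ ∧ ∀ (ξ : Dual K A) (η : Dual K C) (b : B), b ≠ 0 →
      (∀ a c, T a b c = ξ a * η c) → ξ ∈ U := by
  have hdual : 2 ≤ finrank K (Dual K A) := by rwa [Subspace.dual_finrank_eq]
  by_cases hbad : ∃ (ξ₁ : Dual K A) (η₁ : Dual K C) (b₁ : B), b₁ ≠ 0 ∧
      (∀ a c, T a b₁ c = ξ₁ a * η₁ c)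
  swap
  · push Not at hbad
    have : Nontrivial (Dual K A) := Module.nontrivial_of_finrank_pos (R := K) (by omega)
    refine ⟨⊥, bot_ne_top, fun ξ η b hb hs => ?_⟩
    obtain ⟨a, c, hne⟩ := hbad ξ η b hb
    exact absurd (hs a c) hne
  obtain ⟨ξ₁, η₁, b₁, hb₁, hs₁⟩ := hbad
  have ne0 : ∀ (ξ : Dual K A) (η : Dual K C) (b : B), b ≠ 0 →
      (∀ a c, T a b c = ξ a * η c) → ξ ≠ 0 ∧ η ≠ 0 := by
    intro ξ η b hb hs
    constructor <;> rintro rfl <;> exact hb (hT.snd b (by simp [hs]))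
  -- Two rank one slices with both pairs of factors independent would be diagonal in dual vectors,
  -- giving a unit tensor of size two.
  have par : ∀ (ξ ξ' : Dual K A) (η η' : Dual K C) (b b' : B), b ≠ 0 → b' ≠ 0 →
      (∀ a c, T a b c = ξ a * η c) → (∀ a c, T a b' c = ξ' a * η' c) →
      LinearIndependent K ![ξ, ξ'] → ∃ t : K, η' = t • η := by
    intro ξ ξ' η η' b b' hb hb' hs hs' hl
    by_contra hcon
    push Not at hcon
    refine h (hasUnitTwo_of_rank_one_pair hs hs' hl ?_)
    rw [LinearIndependent.pair_iff' (ne0 _ _ _ hb hs).2]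
    exact fun t ht => hcon t ht.symm
  have hξ₁ := (ne0 _ _ _ hb₁ hs₁).1
  by_cases hall : ∀ (ξ : Dual K A) (η : Dual K C) (b : B), b ≠ 0 →
      (∀ a c, T a b c = ξ a * η c) → ξ ∈ K ∙ ξ₁
  · refine ⟨K ∙ ξ₁, fun htop => ?_, hall⟩
    have := finrank_span_singleton (K := K) hξ₁
    rw [htop, finrank_top] at this
    omega
  push Not at hall
  obtain ⟨ξ₂, η₂, b₂, hb₂, hs₂, hn⟩ := hall
  have hli : LinearIndependent K ![ξ₁, ξ₂] := by
    rw [LinearIndependent.pair_iff' hξ₁]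
    exact fun t ht => hn (Submodule.mem_span_singleton.2 ⟨t, ht⟩)
  obtain ⟨s, hs⟩ := par _ _ _ _ _ _ hb₁ hb₂ hs₁ hs₂ hli
  -- Two independent left factors force every right factor onto the line of `η₁`, so all left
  -- factors lie in one space of slice functionals.
  refine ⟨sliceFunctionals T η₁, fun htop => h (hasUnitTwo_of_sliceFunctionals_eq_top hT hA hC
    (ne0 _ _ _ hb₁ hs₁).2 htop), fun ξ η b hb hsl => ?_⟩
  have key : ∃ t : K, η = t • η₁ := by
    -- A left factor proportional to `ξ₁` is independent of `ξ₂`, so it is compared with `b₂`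
    -- instead of `b₁`.
    by_cases h1 : ∃ r : K, r • ξ₁ = ξ
    · obtain ⟨r, rfl⟩ := h1
      have hr : r ≠ 0 := by rintro rfl; simpa using (ne0 _ _ _ hb hsl).1
      have hli2 : LinearIndependent K ![ξ₂, r • ξ₁] := by
        rw [LinearIndependent.pair_iff' (ne0 _ _ _ hb₂ hs₂).1]
        intro t ht
        rcases eq_or_ne t 0 with rfl | ht0
        · rw [zero_smul] at ht
          exact (ne0 _ _ _ hb hsl).1 ht.symm
        · refine hn (Submodule.mem_span_singleton.2 ⟨t⁻¹ * r, ?_⟩)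
          rw [mul_smul, ← ht, smul_smul, inv_mul_cancel₀ ht0, one_smul]
      obtain ⟨t, ht⟩ := par _ _ _ _ _ _ hb₂ hb hs₂ hsl hli2
      exact ⟨t * s, by rw [ht, hs, smul_smul]⟩
    · push Not at h1
      exact par _ _ _ _ _ _ hb₁ hb hs₁ hsl (by rwa [LinearIndependent.pair_iff' hξ₁])
  obtain ⟨t, rfl⟩ := key
  by_cases ht : t = 0
  · exact absurd (by simp [ht]) (ne0 _ _ _ hb hsl).2
  exact ⟨t⁻¹ • b, fun a c => by simp [hsl]; field_simp⟩

/-- Exchange of the last two arguments of a trilinear form. -/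
def flipLast (T : A →ₗ[K] B →ₗ[K] C →ₗ[K] K) : A →ₗ[K] C →ₗ[K] B →ₗ[K] K :=
  (LinearMap.lflip (R₀ := K)).toLinearMap ∘ₗ T

@[simp]
theorem flipLast_apply (a : A) (b : B) (c : C) : flipLast T a c b = T a b c := rfl

theorem Concise.flip (hT : Concise T) : Concise T.flip :=
  ⟨fun b h => hT.snd b fun a c => h a c, fun a h => hT.fst a fun b c => h b c,
    fun c h => hT.thd c fun a b => h b a⟩

theorem Concise.flipLast (hT : Concise T) : Concise (flipLast T) :=
  ⟨fun a h => hT.fst a fun b c => h c b, fun c h => hT.thd c fun a b => h a b,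
    fun b h => hT.snd b fun a c => h a c⟩

theorem HasUnitTwo.of_flip (h : HasUnitTwo T.flip) : HasUnitTwo T := by
  obtain ⟨a, b, c, h⟩ := h
  exact ⟨b, a, c, fun i j k => by have := h j i k; simp_all [arrUnit]; grind⟩

theorem HasUnitTwo.of_flipLast (h : HasUnitTwo (_root_.flipLast T)) : HasUnitTwo T := by
  obtain ⟨a, b, c, h⟩ := h
  exact ⟨a, c, b, fun i j k => by have := h i k j; simp_all [arrUnit]; grind⟩

theorem HasUnitTwo.of_domRestrict {H : Submodule K A} (h : HasUnitTwo (T.domRestrict H)) :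
    HasUnitTwo T := by
  obtain ⟨a, b, c, h⟩ := h
  exact ⟨fun i => a i, b, c, h⟩

/-- If restriction to the kernel of `ξ` loses conciseness at `b`, then the slice of `T` at `b` is
`ξ` times a functional on `C`, hence of rank one; likewise for `C`. It suffices to take `ξ` outside
the two proper subspaces that contain all such left factors. -/
theorem exists_hyperplane_concise [FiniteDimensional K A] [FiniteDimensional K B]
    [FiniteDimensional K C] (hT : Concise T) (hA : 2 ≤ finrank K A) (hB : 2 ≤ finrank K B)
    (hC : 2 ≤ finrank K C) (h : ¬ HasUnitTwo T) :
    ∃ H : Submodule K A, finrank K H + 1 = finrank K A ∧ Concise (T.domRestrict H) := by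
  obtain ⟨U, hU, hU'⟩ := exists_proper_of_not_hasUnitTwo hT hA hC h
  obtain ⟨W, hW, hW'⟩ := exists_proper_of_not_hasUnitTwo hT.flipLast hA hB
    fun h' => h h'.of_flipLast
  obtain ⟨ξ, h1, h2⟩ := exists_notMem_union hU hW
  have hξ : ξ ≠ 0 := fun h0 => h1 (h0 ▸ U.zero_mem)
  obtain ⟨a₀, ha₀⟩ : ∃ a, ξ a = 1 := by
    obtain ⟨u, hu⟩ : ∃ u, ξ u ≠ 0 := by
      by_contra! h'
      exact hξ (LinearMap.ext h')
    exact ⟨(ξ u)⁻¹ • u, by simp [hu]⟩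
  have hmem : ∀ a, a - ξ a • a₀ ∈ LinearMap.ker ξ := fun a => by simp [ha₀]
  refine ⟨LinearMap.ker ξ, Module.Dual.finrank_ker_add_one_of_ne_zero hξ, ?_, ?_, ?_⟩
  · exact fun a ha => Subtype.ext (hT.fst a fun b c => ha b c)
  · intro b hb
    by_contra hb0
    refine h1 (hU' ξ (T a₀ b) b hb0 fun a c => ?_)
    have := hb ⟨_, hmem a⟩ c
    simp only [LinearMap.domRestrict_apply, map_sub, map_smul, LinearMap.sub_apply,
      LinearMap.smul_apply, smul_eq_mul] at this
    linear_combination this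
  · intro c hc
    by_contra hc0
    refine h2 (hW' ξ ((T a₀).flip c) c hc0 fun a b => ?_)
    have := hc ⟨_, hmem a⟩ b
    simp only [LinearMap.domRestrict_apply, map_sub, map_smul, LinearMap.sub_apply,
      LinearMap.smul_apply, smul_eq_mul] at this
    simp only [flipLast_apply, LinearMap.flip_apply]
    linear_combination this

end Trilinear

/-! ### Reduction to dimension two -/

section Dimension

universe u

/-- A concise trilinear form without unit tensor of size two has a nondegenerate slice. -/
theorem exists_nondegenerate_slice {K : Type*} {B C : Type*} [Field K] [AddCommGroup B]
    [Module K B] [AddCommGroup C] [Module K C] [FiniteDimensional K B] [FiniteDimensional K C]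
    (hB : 2 ≤ finrank K B) (hC : 2 ≤ finrank K C) (n : ℕ) :
    ∀ (A : Type u) [AddCommGroup A] [Module K A] [FiniteDimensional K A]
      (T : A →ₗ[K] B →ₗ[K] C →ₗ[K] K), finrank K A = n + 1 → Concise T → ¬ HasUnitTwo T →
      ∃ a, (∀ b, (∀ c, T a b c = 0) → b = 0) ∧ (∀ c, (∀ b, T a b c = 0) → c = 0) := by
  induction n with
  | zero =>
    intro A _ _ _ T hA hT h
    obtain ⟨a, -, ha⟩ := finrank_eq_one_iff'.1 hA
    refine ⟨a, fun b hb => hT.snd b fun a' c => ?_, fun c hc => hT.thd c fun a' b => ?_⟩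
    · obtain ⟨t, rfl⟩ := ha a'
      simp [hb]
    · obtain ⟨t, rfl⟩ := ha a'
      simp [hc]
  | succ n ih =>
    intro A _ _ _ T hA hT h
    -- Shrinking `A` keeps conciseness in `B` and `C`; once `A` is a line, conciseness says exactly
    -- that its slice is nondegenerate.
    obtain ⟨H, hH, hc⟩ := exists_hyperplane_concise hT (by omega) hB hC h
    obtain ⟨a, ha⟩ := ih H (T.domRestrict H) (by omega) hc fun h' => h h'.of_domRestrict
    exact ⟨a, ha⟩

/-- A nondegenerate slice pairs `B` with `C` and embeds each in the dual of the other. -/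
theorem finrank_eq_of_not_hasUnitTwo {K : Type*} {A : Type u} {B C : Type*} [Field K]
    [AddCommGroup A] [Module K A] [AddCommGroup B] [Module K B] [AddCommGroup C] [Module K C]
    [FiniteDimensional K A] [FiniteDimensional K B] [FiniteDimensional K C]
    {T : A →ₗ[K] B →ₗ[K] C →ₗ[K] K} (hA : 2 ≤ finrank K A) (hB : 2 ≤ finrank K B)
    (hC : 2 ≤ finrank K C) (hT : Concise T) (h : ¬ HasUnitTwo T) :
    finrank K B = finrank K C := by
  obtain ⟨a, h1, h2⟩ := exists_nondegenerate_slice hB hC (finrank K A - 1) A T (by omega) hT h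
  apply le_antisymm
  · rw [← Subspace.dual_finrank_eq (V := C)]
    refine LinearMap.finrank_le_finrank_of_injective (f := T a) ?_
    rw [injective_iff_map_eq_zero]
    exact fun b hb => h1 b fun c => by simp [hb]
  · rw [← Subspace.dual_finrank_eq (V := B)]
    refine LinearMap.finrank_le_finrank_of_injective (f := (T a).flip) ?_
    rw [injective_iff_map_eq_zero]
    exact fun c hc => h2 c fun b => by simpa using congrArg (· b) hc

theorem finrank_eq_two_of_not_hasUnitTwo {K : Type*} {A B C : Type*} [Field K]
    [AddCommGroup A] [Module K A] [AddCommGroup B] [Module K B] [AddCommGroup C] [Module K C]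
    [FiniteDimensional K A] [FiniteDimensional K B] [FiniteDimensional K C]
    {T : A →ₗ[K] B →ₗ[K] C →ₗ[K] K} (hA : 2 ≤ finrank K A) (hB : 2 ≤ finrank K B)
    (hC : 2 ≤ finrank K C) (hT : Concise T) (h : ¬ HasUnitTwo T) :
    finrank K A = 2 ∧ finrank K B = 2 ∧ finrank K C = 2 := by
  have e1 := finrank_eq_of_not_hasUnitTwo hA hB hC hT h
  have e2 := finrank_eq_of_not_hasUnitTwo hB hA hC hT.flip fun h' => h h'.of_flip
  -- All three dimensions agree. If they exceeded two, a concise hyperplane of `A` would still have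
  -- dimension at least two, so it would have the dimension of `C`, one more than it can have.
  by_contra hne
  obtain ⟨H, hH, hc⟩ := exists_hyperplane_concise hT hA hB hC h
  have e3 := finrank_eq_of_not_hasUnitTwo (T := (T.domRestrict H).flip) hB (by omega) hC hc.flip
    fun h' => h h'.of_flip.of_domRestrict
  omega

end Dimension

/-! ### Normal forms of `2 × 2` pencils -/

section PencilNormalForm

variable {K : Type*} [Field K]

/-- The `2 × 2 × 2` array with slices `1` and `m`. -/
def pencil (m : Matrix (Fin 2) (Fin 2) K) (i j k : Fin 2) : K :=
  (![1, m] : Fin 2 → Matrix (Fin 2) (Fin 2) K) k i j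

/-- The array of the `W`-tensor. -/
def wArr (K : Type*) [Field K] (i j k : Fin 2) : K :=
  if (i : ℕ) + j + k = 1 then 1 else 0

/-- A `2 × 2` matrix which is not a multiple of the identity. -/
def IsNonscalar (m : Matrix (Fin 2) (Fin 2) K) : Prop :=
  m 0 1 ≠ 0 ∨ m 1 0 ≠ 0 ∨ m 0 0 ≠ m 1 1

/-- The columns of `P` are `m v` and `v`, with `v` a cyclic vector. Their determinant is a binary
quadratic form in `v = (x, y)`, and one of the three test vectors below makes it nonzero, whatever
the field. -/
theorem IsNonscalar.exists_cyclic {m : Matrix (Fin 2) (Fin 2) K} (h : IsNonscalar m) :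
    ∃ P : Matrix (Fin 2) (Fin 2) K, P.det ≠ 0 ∧ ∀ i, P i 0 = ∑ j, m i j * P j 1 := by
  have H : ∀ x y : K, m 0 1 * y ^ 2 + (m 0 0 - m 1 1) * x * y - m 1 0 * x ^ 2 ≠ 0 →
      ∃ P : Matrix (Fin 2) (Fin 2) K, P.det ≠ 0 ∧ ∀ i, P i 0 = ∑ j, m i j * P j 1 := by
    intro x y hxy
    refine ⟨!![m 0 0 * x + m 0 1 * y, x; m 1 0 * x + m 1 1 * y, y], ?_, fun i => ?_⟩
    · rw [Matrix.det_fin_two_of]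
      convert hxy using 1
      ring
    · fin_cases i <;> simp
  by_cases h1 : m 0 1 = 0
  · by_cases h2 : m 1 0 = 0
    · refine H 1 1 ?_
      have : m 0 0 ≠ m 1 1 := by simpa [IsNonscalar, h1, h2] using h
      simpa [h1, h2, sub_eq_zero] using this
    · exact H 1 0 (by simpa using h2)
  · exact H 0 1 (by simpa using h1)

theorem IsNonscalar.transpose {m : Matrix (Fin 2) (Fin 2) K} (h : IsNonscalar m) :
    IsNonscalar m.transpose := by
  simp only [IsNonscalar, Matrix.transpose_apply] at h ⊢
  tauto

theorem ArrRestricts.slices_mul {α β α' β' γ : Type*} [Fintype α] [Fintype β] [Fintype γ]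
    (s : γ → Matrix α β K) (A : Matrix α' α K) (B : Matrix β β' K) :
    ArrRestricts (fun i j k => s k i j) (fun i j k => (A * s k * B) i j) := by
  classical
  refine ⟨A, B.transpose, fun k z => if z = k then 1 else 0, fun i j k => ?_⟩
  simp only [Matrix.mul_apply, Finset.sum_mul, Matrix.transpose_apply, mul_ite, mul_one, mul_zero,
    ite_mul, zero_mul, Finset.sum_ite_eq', Finset.mem_univ, if_true]
  rw [Finset.sum_comm]
  refine Finset.sum_congr rfl fun x _ => Finset.sum_congr rfl fun y _ => by ring

theorem pencil_conj (m P Q : Matrix (Fin 2) (Fin 2) K) (h : Q * P = 1) :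
    ArrRestricts (pencil m) (pencil (Q * m * P)) := by
  have := ArrRestricts.slices_mul (![1, m] : Fin 2 → Matrix (Fin 2) (Fin 2) K) Q P
  refine this.trans (ArrRestricts.of_eq id id id fun i j k => ?_)
  fin_cases k <;> simp [pencil, h]

theorem pencil_shift (m : Matrix (Fin 2) (Fin 2) K) (μ : K) :
    ArrRestricts (pencil m) (pencil (m - μ • 1)) := by
  classical
  refine ⟨fun i x => if x = i then 1 else 0, fun i x => if x = i then 1 else 0,
    ![![1, 0], ![-μ, 1]], fun i j k => ?_⟩
  fin_cases i <;> fin_cases j <;> fin_cases k <;> simp [pencil] <;> ring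

theorem pencil_diag (τ : K) (hτ : τ ≠ 0) :
    ArrRestricts (pencil !![τ, 0; 0, 0]) (arrUnit K (Fin 2)) := by
  -- The combinations `τ⁻¹ m` and `1 - τ⁻¹ m` of the slices are the two diagonal idempotents.
  refine ⟨fun i x => if x = i then 1 else 0, fun i x => if x = i then 1 else 0,
    ![![0, τ⁻¹], ![1, -τ⁻¹]], fun i j k => ?_⟩
  fin_cases i <;> fin_cases j <;> fin_cases k <;> simp [pencil, arrUnit, hτ]

/-- Swapping the two values of the second index turns the slices of `W` into the identity and a
nilpotent Jordan block. -/
theorem pencil_restricts_wArr :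
    ArrRestricts (pencil (!![0, 1; 0, 0] : Matrix (Fin 2) (Fin 2) K)) (wArr K) := by
  refine ArrRestricts.of_eq id ![1, 0] id fun i j k => ?_
  fin_cases i <;> fin_cases j <;> fin_cases k <;> simp [pencil, wArr]

theorem wArr_restricts_pencil :
    ArrRestricts (wArr K) (pencil (!![0, 1; 0, 0] : Matrix (Fin 2) (Fin 2) K)) := by
  refine ArrRestricts.of_eq id ![1, 0] id fun i j k => ?_
  fin_cases i <;> fin_cases j <;> fin_cases k <;> simp [pencil, wArr]

/-- A pencil with a singular, nonzero member restricts to the unit array, or is the `W`-array. -/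
theorem pencil_dichotomy {m : Matrix (Fin 2) (Fin 2) K} {μ : K} (hm : IsNonscalar m)
    (hμ : (m - μ • (1 : Matrix (Fin 2) (Fin 2) K)).det = 0) :
    ArrRestricts (pencil m) (arrUnit K (Fin 2)) ∨
      (ArrRestricts (pencil m) (wArr K) ∧ ArrRestricts (wArr K) (pencil m)) := by
  set n := m - μ • (1 : Matrix (Fin 2) (Fin 2) K) with hn
  have hns : IsNonscalar n := by
    simpa [IsNonscalar, hn] using hm
  have h1 : ArrRestricts (pencil m) (pencil n) := pencil_shift m μ
  have h2 : ArrRestricts (pencil n) (pencil m) := by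
    have := pencil_shift n (-μ)
    rwa [show n - (-μ) • (1 : Matrix (Fin 2) (Fin 2) K) = m by simp [hn]] at this
  obtain ⟨P, hP, hPm⟩ := hns.exists_cyclic
  rw [Matrix.det_fin_two] at hμ
  simp only [Fin.sum_univ_two, Fin.forall_fin_two] at hPm
  obtain ⟨e0, e1⟩ := hPm
  rw [Matrix.det_fin_two] at hP
  by_cases hτ : n 0 0 + n 1 1 = 0
  -- The trace and determinant of `n` vanish, so `n ^ 2 = 0` by Cayley–Hamilton, and `n` is a Jordan
  -- block in the basis `n v, v`.
  · right
    have hPu : IsUnit P.det := by rw [Matrix.det_fin_two]; exact hP.isUnit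
    have hnP : n * P = P * !![0, 1; 0, 0] := by
      ext i j
      fin_cases i <;> fin_cases j <;> simp [Matrix.mul_apply, e0, e1]
      · linear_combination (n 0 0 * P 0 1 + n 0 1 * P 1 1) * hτ - P 0 1 * hμ
      · linear_combination (n 1 0 * P 0 1 + n 1 1 * P 1 1) * hτ - P 1 1 * hμ
    have e : P⁻¹ * n * P = !![0, 1; 0, 0] := by
      rw [mul_assoc, hnP, ← mul_assoc, Matrix.nonsing_inv_mul _ hPu, one_mul]
    have e' : P * !![0, 1; 0, 0] * P⁻¹ = n := by
      rw [← hnP, mul_assoc, Matrix.mul_nonsing_inv _ hPu, mul_one]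
    constructor
    · refine h1.trans (ArrRestricts.trans ?_ pencil_restricts_wArr)
      rw [← e]
      exact pencil_conj _ _ _ (Matrix.nonsing_inv_mul _ hPu)
    · refine (wArr_restricts_pencil.trans ?_).trans h2
      conv_rhs => rw [← e']
      exact pencil_conj _ _ _ (Matrix.mul_nonsing_inv _ hPu)
  · left
    set τ := n 0 0 + n 1 1 with hτ'
    -- The eigenvalues are now `τ ≠ 0` and `0`, with eigenvectors `n v` and `τ v - n v`; the
    -- determinant of `R` is `τ` times that of `P`.
    set R : Matrix (Fin 2) (Fin 2) K := !![P 0 0, τ * P 0 1 - P 0 0; P 1 0, τ * P 1 1 - P 1 0]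
      with hR
    have hRu : IsUnit R.det := by
      rw [hR, Matrix.det_fin_two_of]
      refine IsUnit.mk0 _ ?_
      convert mul_ne_zero hτ hP using 1
      ring
    have hnR : n * R = R * !![τ, 0; 0, 0] := by
      ext i j
      fin_cases i <;> fin_cases j <;> simp [Matrix.mul_apply, hR, e0, e1, hτ']
      · linear_combination - P 0 1 * hμ
      · linear_combination P 0 1 * hμ
      · linear_combination - P 1 1 * hμ
      · linear_combination P 1 1 * hμ
    have e : R⁻¹ * n * R = !![τ, 0; 0, 0] := by
      rw [mul_assoc, hnR, ← mul_assoc, Matrix.nonsing_inv_mul _ hRu, one_mul]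
    refine h1.trans (ArrRestricts.trans ?_ (pencil_diag τ hτ))
    rw [← e]
    exact pencil_conj _ _ _ (Matrix.nonsing_inv_mul _ hRu)

/-- The square of a nonscalar pencil restricts to the unit array. -/
theorem pencil_sq_restricts_unit {m : Matrix (Fin 2) (Fin 2) K} (hm : IsNonscalar m) :
    ArrRestricts (arrPow (pencil m) 2) (arrUnit K (Fin 2)) := by
  have h1 : ArrRestricts (pencil m)
      (fun (i j : Fin 2) (_ : Fin 1) => if i = j then (1 : K) else 0) := by
    refine ArrRestricts.of_eq id id (fun _ => 0) fun i j k => ?_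
    simp [pencil, Matrix.one_apply]
  -- Contracting the first leg with a cyclic vector `v` of the transpose leaves the independent rows
  -- `v` and `v m`, hence an identity matrix between the other two legs. No eigenvalue in `K` is
  -- needed.
  have h2 : ArrRestricts (pencil m)
      (fun (_ : Fin 1) (j k : Fin 2) => if j = k then (1 : K) else 0) := by
    obtain ⟨P, hP, hPm⟩ := hm.transpose.exists_cyclic
    have hPu : IsUnit P.det := hP.isUnit
    obtain ⟨Q, hinv⟩ : ∃ Q, Q * P = 1 := ⟨P⁻¹, Matrix.nonsing_inv_mul _ hPu⟩
    refine ⟨fun _ x => P x 1, Q, ![![0, 1], ![1, 0]], fun i j k => ?_⟩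
    have hj := congrFun (congrFun hinv j) k
    rw [Matrix.one_apply] at hj
    refine hj.symm.trans ?_
    simp only [Matrix.transpose_apply, Fin.sum_univ_two, Fin.forall_fin_two] at hPm
    fin_cases k
    · simp [pencil, Matrix.mul_apply, Fin.sum_univ_two, hPm.1, hPm.2]
      ring
    · simp [pencil, Matrix.mul_apply, Fin.sum_univ_two, Matrix.one_apply]
      ring
  refine ((arrPow_add _ 1 1).trans (ArrRestricts.kron ((arrPow_one _).trans h1)
    ((arrPow_one _).trans h2))).trans ?_
  -- One factor links legs one and two, the other links legs two and three; the diagonal of the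
  -- middle leg links all three.
  refine ArrRestricts.of_eq (fun i => (i, 0)) (fun j => (j, j)) (fun k => (0, k)) fun i j k => ?_
  simp only [arrUnit, arrKron, ite_and, ite_mul, one_mul, zero_mul]

end PencilNormalForm

/-! ### Concise reduction and the trichotomy for arrays -/

section ArrayForm

variable {K α β γ : Type*} [Field K] [Fintype α] [Fintype β] [Fintype γ]

/-- The trilinear form of an array. -/
def arrForm (t : α → β → γ → K) : (α → K) →ₗ[K] (β → K) →ₗ[K] (γ → K) →ₗ[K] K :=
  ∑ x, ∑ y, ∑ z, (LinearMap.proj x : (α → K) →ₗ[K] K).smulRight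
    ((LinearMap.proj y : (β → K) →ₗ[K] K).smulRight
      (t x y z • (LinearMap.proj z : (γ → K) →ₗ[K] K)))

theorem arrForm_apply (t : α → β → γ → K) (a : α → K) (b : β → K) (c : γ → K) :
    arrForm t a b c = ∑ x, ∑ y, ∑ z, a x * b y * c z * t x y z := by
  simp only [arrForm, LinearMap.sum_apply, LinearMap.smulRight_apply, LinearMap.smul_apply,
    LinearMap.proj_apply, smul_eq_mul]
  refine Finset.sum_congr rfl fun x _ => Finset.sum_congr rfl fun y _ =>
      Finset.sum_congr rfl fun w _ => by ring

theorem arrForm_single [DecidableEq α] [DecidableEq β] [DecidableEq γ] (t : α → β → γ → K)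
    (x : α) (y : β) (z : γ) :
    arrForm t (Pi.single x 1) (Pi.single y 1) (Pi.single z 1) = t x y z := by
  simp [arrForm_apply, Pi.single_apply, ite_mul]

/-- The rows of the three matrices are the vectors at which the form is evaluated. -/
theorem ArrRestricts.of_form {t : α → β → γ → K} {α' β' γ' : Type*} {s : α' → β' → γ' → K}
    (a : α' → α → K) (b : β' → β → K) (c : γ' → γ → K)
    (h : ∀ i j k, s i j k = arrForm t (a i) (b j) (c k)) : ArrRestricts t s :=
  ⟨a, b, c, fun i j k => by rw [h, arrForm_apply]⟩

end ArrayForm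

theorem exists_complement_ker {K A V : Type*} [Field K] [AddCommGroup A] [Module K A]
    [AddCommMonoid V] [Module K V] (f : A →ₗ[K] V) :
    ∃ A' : Submodule K A, (∀ a, ∃ a' : A', f a = f a') ∧ ∀ a' : A', f a' = 0 → a' = 0 := by
  obtain ⟨A', hA'⟩ := Submodule.exists_isCompl (LinearMap.ker f)
  refine ⟨A', fun a => ?_, fun a' h => ?_⟩
  · have : a ∈ LinearMap.ker f ⊔ A' := hA'.sup_eq_top ▸ Submodule.mem_top
    obtain ⟨k, hk, a', ha', rfl⟩ := Submodule.mem_sup.1 this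
    exact ⟨⟨a', ha'⟩, by rw [map_add, LinearMap.mem_ker.1 hk, zero_add]⟩
  · have : (a' : A) ∈ LinearMap.ker f ⊓ A' := ⟨h, a'.2⟩
    rw [hA'.inf_eq_bot] at this
    exact Subtype.ext ((Submodule.mem_bot K).1 this)

section Restriction

variable {K A B C : Type*} [Field K] [AddCommGroup A] [Module K A] [AddCommGroup B]
    [Module K B] [AddCommGroup C] [Module K C]

/-- Restriction of a trilinear form to subspaces. -/
def restrictForm (T : A →ₗ[K] B →ₗ[K] C →ₗ[K] K) (A' : Submodule K A) (B' : Submodule K B)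
    (C' : Submodule K C) : A' →ₗ[K] B' →ₗ[K] C' →ₗ[K] K :=
  (T.compl₁₂ A'.subtype B'.subtype).compr₂ (LinearMap.lcomp K K C'.subtype)

@[simp]
theorem restrictForm_apply (T : A →ₗ[K] B →ₗ[K] C →ₗ[K] K) (A' : Submodule K A)
    (B' : Submodule K B) (C' : Submodule K C) (a : A') (b : B') (c : C') :
    restrictForm T A' B' C' a b c = T a b c := rfl

/-- In each argument a complement of the kernel represents every vector as far as `T` can tell, so
all three restrictions can be made at once without creating new kernels. -/
theorem exists_concise_restriction (T : A →ₗ[K] B →ₗ[K] C →ₗ[K] K) :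
    ∃ (A' : Submodule K A) (B' : Submodule K B) (C' : Submodule K C),
      (∀ a, ∃ a' : A', ∀ b c, T a b c = T a' b c) ∧
      (∀ b, ∃ b' : B', ∀ a c, T a b c = T a b' c) ∧
      (∀ c, ∃ c' : C', ∀ a b, T a b c = T a b c') ∧
      Concise (restrictForm T A' B' C') := by
  obtain ⟨A', hA, hA0⟩ := exists_complement_ker T
  obtain ⟨B', hB, hB0⟩ := exists_complement_ker T.flip
  obtain ⟨C', hC, hC0⟩ := exists_complement_ker (flipLast T).flip
  have hA' : ∀ a, ∃ a' : A', ∀ b c, T a b c = T a' b c := fun a => by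
    obtain ⟨a', h⟩ := hA a
    exact ⟨a', fun b c => by rw [h]⟩
  have hB' : ∀ b, ∃ b' : B', ∀ a c, T a b c = T a b' c := fun b => by
    obtain ⟨b', h⟩ := hB b
    exact ⟨b', fun a c => congrArg (fun f => f a c) h⟩
  have hC' : ∀ c, ∃ c' : C', ∀ a b, T a b c = T a b c' := fun c => by
    obtain ⟨c', h⟩ := hC c
    exact ⟨c', fun a b => congrArg (fun f => f a b) h⟩
  refine ⟨A', B', C', hA', hB', hC', fun a h => hA0 a ?_, fun b h => hB0 b ?_,
    fun c h => hC0 c ?_⟩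
  · ext b c
    obtain ⟨b', hb⟩ := hB' b
    obtain ⟨c', hc⟩ := hC' c
    rw [hb, hc]
    exact h b' c'
  · ext a c
    obtain ⟨a', ha⟩ := hA' a
    obtain ⟨c', hc⟩ := hC' c
    rw [LinearMap.flip_apply, ha, hc]
    exact h a' c'
  · ext a b
    obtain ⟨a', ha⟩ := hA' a
    obtain ⟨b', hb⟩ := hB' b
    rw [LinearMap.flip_apply, flipLast_apply, ha, hb]
    exact h a' b'

theorem form_eq_sum_basis {ι κ ν : Type*} [Fintype ι] [Fintype κ] [Fintype ν]
    (T : A →ₗ[K] B →ₗ[K] C →ₗ[K] K) (u : Basis ι K A) (v : Basis κ K B) (w : Basis ν K C)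
    (a : A) (b : B) (c : C) :
    T a b c = ∑ x, ∑ y, ∑ z, u.repr a x * v.repr b y * w.repr c z * T (u x) (v y) (w z) := by
  have h1 : ∀ b c, T a b c = ∑ x, u.repr a x * T (u x) b c := fun b c => by
    conv_lhs => rw [← u.sum_repr a]
    simp only [map_sum, map_smul, LinearMap.sum_apply, LinearMap.smul_apply, smul_eq_mul]
  have h2 : ∀ a c, T a b c = ∑ y, v.repr b y * T a (v y) c := fun a c => by
    conv_lhs => rw [← v.sum_repr b]
    simp only [map_sum, map_smul, LinearMap.sum_apply, LinearMap.smul_apply, smul_eq_mul]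
  have h3 : ∀ a b, T a b c = ∑ z, w.repr c z * T a b (w z) := fun a b => by
    conv_lhs => rw [← w.sum_repr c]
    simp only [map_sum, map_smul, smul_eq_mul]
  rw [h1]
  refine Finset.sum_congr rfl fun x _ => ?_
  rw [h2, Finset.mul_sum]
  refine Finset.sum_congr rfl fun y _ => ?_
  rw [h3, Finset.mul_sum, Finset.mul_sum]
  refine Finset.sum_congr rfl fun z _ => by ring

/-- A concise `2 × 2 × 2` form without unit tensor is a nonscalar pencil in suitable bases. -/
theorem exists_pencil_basis [FiniteDimensional K A] [FiniteDimensional K B]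
    [FiniteDimensional K C] {T : A →ₗ[K] B →ₗ[K] C →ₗ[K] K} (hT : Concise T)
    (h : ¬ HasUnitTwo T) (hA : finrank K A = 2) (hB : finrank K B = 2) (hC : finrank K C = 2) :
    ∃ (m : Matrix (Fin 2) (Fin 2) K) (u : Basis (Fin 2) K A) (v : Basis (Fin 2) K B)
      (w : Basis (Fin 2) K C), IsNonscalar m ∧
      ∀ i j k, pencil m i j k = T (u i) (v j) (w k) := by
  -- A nondegenerate slice in the third direction is taken as the first member of the pencil;
  -- choosing `v` dual to `u` under it makes it the identity matrix.
  obtain ⟨c₀, h1, h2⟩ := exists_nondegenerate_slice hA.ge hB.ge 1 C (flipLast T).flip hC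
    hT.flipLast.flip fun h' => h h'.of_flip.of_flipLast
  simp only [LinearMap.flip_apply, flipLast_apply] at h1 h2
  have hAn : Nontrivial A := Module.nontrivial_of_finrank_pos (R := K) (by omega)
  have hc₀ : c₀ ≠ 0 := by
    rintro rfl
    obtain ⟨a, ha⟩ := exists_ne (0 : A)
    exact ha (h1 a fun b => by simp)
  obtain ⟨c₁, hc⟩ := exists_linearIndependent_of_two_le_finrank hC.ge hc₀
  let w := basisOfLinearIndependentOfCardEqFinrank hc (by simp [hC])
  have hw0 : w 0 = c₀ := by simp [w]
  have hw1 : w 1 = c₁ := by simp [w]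
  let u := finBasisOfFinrankEq K A hA
  let φ : B →ₗ[K] (Fin 2 → K) := LinearMap.pi fun i => (T (u i)).flip c₀
  have hφ : Function.Injective φ := by
    rw [injective_iff_map_eq_zero]
    refine fun b hb => h2 b fun a => ?_
    have h0 : (T.flip b).flip c₀ = 0 := u.ext fun i => congrFun hb i
    exact congrArg (fun f => f a) h0
  let v : Basis (Fin 2) K B := Basis.ofEquivFun
    (LinearEquiv.ofInjectiveOfFinrankEq φ hφ (by simp [hB]))
  have hv : ∀ i j, T (u i) (v j) c₀ = if i = j then 1 else 0 := by
    intro i j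
    have : φ (v j) = Pi.single j 1 := by
      rw [Basis.coe_ofEquivFun]
      exact (LinearEquiv.ofInjectiveOfFinrankEq φ hφ (by simp [hB])).apply_symm_apply
        (Pi.single j 1)
    have := congrFun this i
    simpa [φ, Pi.single_apply] using this
  refine ⟨fun i j => T (u i) (v j) c₁, u, v, w, ?_, fun i j k => ?_⟩
  -- If the second slice were `μ` times the identity, `μ • c₀ - c₁` would be in the kernel of the
  -- third argument, against the independence of `c₀` and `c₁`.
  · by_contra hns
    simp only [IsNonscalar, not_or, not_not] at hns
    obtain ⟨e1, e2, e3⟩ := hns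
    rw [LinearIndependent.pair_iff' hc₀] at hc
    set μ := T (u 0) (v 0) c₁ with hμ
    refine hc μ ?_
    rw [← sub_eq_zero]
    refine hT.thd _ fun a b => ?_
    have h0 : ∀ i j, T (u i) (v j) (μ • c₀ - c₁) = 0 := by
      simp only [map_sub, map_smul, hv, Fin.forall_fin_two, e1, e2, ← e3, ← hμ]
      simp
    have h0' : ∀ i, (T (u i)).flip (μ • c₀ - c₁) = 0 := fun i => v.ext fun j => h0 i j
    have h0'' : (T.flip b).flip (μ • c₀ - c₁) = 0 :=
      u.ext fun i => congrArg (fun f => f b) (h0' i)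
    exact congrArg (fun f => f a) h0''
  · fin_cases k
    · change (1 : Matrix (Fin 2) (Fin 2) K) i j = T (u i) (v j) (w 0)
      rw [hw0, hv, Matrix.one_apply]
    · change T (u i) (v j) c₁ = T (u i) (v j) (w 1)
      rw [hw1]

end Restriction

/-- An array has flattening rank at most one in some direction, or restricts to the unit array of
size two, or is equivalent to a nonscalar pencil. -/
theorem array_trichotomy {K α β γ : Type*} [Field K] [Fintype α] [Fintype β] [Fintype γ]
    (t : α → β → γ → K) :
    ((∃ (l : α → K) (S : β → γ → K), ∀ x y z, t x y z = l x * S y z) ∨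
      (∃ (l : β → K) (S : α → γ → K), ∀ x y z, t x y z = l y * S x z) ∨
      (∃ (l : γ → K) (S : α → β → K), ∀ x y z, t x y z = l z * S x y)) ∨
    ArrRestricts t (arrUnit K (Fin 2)) ∨
    ∃ m : Matrix (Fin 2) (Fin 2) K, IsNonscalar m ∧ ArrRestricts t (pencil m) ∧
      ArrRestricts (pencil m) t := by
  classical
  obtain ⟨A, B, C, hA, hB, hC, hT⟩ := exists_concise_restriction (arrForm t)
  by_cases h1 : finrank K A ≤ 1
  · left; left
    obtain ⟨v, hv⟩ := finrank_le_one_iff.1 h1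
    have : ∀ x, ∃ r : K, ∀ b c, arrForm t (Pi.single x 1) b c = r * arrForm t v b c := fun x => by
      obtain ⟨a', ha'⟩ := hA (Pi.single x 1)
      obtain ⟨r, rfl⟩ := hv a'
      exact ⟨r, fun b c => by simp [ha']⟩
    choose l hl using this
    exact ⟨l, fun y z => arrForm t v (Pi.single y 1) (Pi.single z 1), fun x y z => by
      rw [← hl, arrForm_single]⟩
  by_cases h2 : finrank K B ≤ 1
  · left; right; left
    obtain ⟨v, hv⟩ := finrank_le_one_iff.1 h2
    have : ∀ y, ∃ r : K, ∀ a c, arrForm t a (Pi.single y 1) c = r * arrForm t a v c := fun y => by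
      obtain ⟨b', hb'⟩ := hB (Pi.single y 1)
      obtain ⟨r, rfl⟩ := hv b'
      exact ⟨r, fun a c => by simp [hb']⟩
    choose l hl using this
    exact ⟨l, fun x z => arrForm t (Pi.single x 1) v (Pi.single z 1), fun x y z => by
      rw [← hl, arrForm_single]⟩
  by_cases h3 : finrank K C ≤ 1
  · left; right; right
    obtain ⟨v, hv⟩ := finrank_le_one_iff.1 h3
    have : ∀ z, ∃ r : K, ∀ a b, arrForm t a b (Pi.single z 1) = r * arrForm t a b v := fun z => by
      obtain ⟨c', hc'⟩ := hC (Pi.single z 1)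
      obtain ⟨r, rfl⟩ := hv c'
      exact ⟨r, fun a b => by simp [hc']⟩
    choose l hl using this
    exact ⟨l, fun x y => arrForm t (Pi.single x 1) (Pi.single y 1) v, fun x y z => by
      rw [← hl, arrForm_single]⟩
  right
  by_cases h : HasUnitTwo (restrictForm (arrForm t) A B C)
  · left
    obtain ⟨a, b, c, h⟩ := h
    exact ArrRestricts.of_form (fun i => a i) (fun i => b i) (fun i => c i)
      fun i j k => (h i j k).symm
  right
  obtain ⟨d1, d2, d3⟩ := finrank_eq_two_of_not_hasUnitTwo (by omega) (by omega) (by omega) hT h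
  obtain ⟨m, u, v, w, hm, hp⟩ := exists_pencil_basis hT h d1 d2 d3
  refine ⟨m, hm, ArrRestricts.of_form (fun i => u i) (fun i => v i) (fun i => w i) hp, ?_⟩
  choose a ha using hA
  choose b hb using hB
  choose c hc using hC
  -- The array is recovered from the pencil by the coordinates of the reduced standard basis
  -- vectors.
  refine ⟨fun x => u.repr (a (Pi.single x 1)), fun y => v.repr (b (Pi.single y 1)),
    fun z => w.repr (c (Pi.single z 1)), fun x y z => ?_⟩
  rw [← arrForm_single t, ha, hb, hc]
  exact (form_eq_sum_basis (restrictForm (arrForm t) A B C) u v w _ _ _).trans (by simp_rw [hp])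

/-! ### Powers of unit arrays -/

section PowUnit

variable {K : Type*} [Field K]

theorem arrPow_arrUnit (ι : Type*) [DecidableEq ι] (N : ℕ) :
    arrPow (arrUnit K ι) N = arrUnit K (Fin N → ι) := by
  ext i j k
  simp only [arrPow, arrUnit]
  rw [Finset.prod_ite_zero]
  simp [funext_iff, forall_and]

theorem ArrRestricts.pow_mul {α β γ α' β' γ' : Type*} [Fintype α] [Fintype β] [Fintype γ]
    [Fintype α'] [Fintype β'] [Fintype γ']
    {t : α → β → γ → K} {s : α' → β' → γ' → K} {k : ℕ} (h : ArrRestricts (arrPow t k) s) (l : ℕ) :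
    ArrRestricts (arrPow t (k * l)) (arrPow s l) := by
  induction l with
  | zero =>
    refine ArrRestricts.of_eq (fun _ => Fin.elim0) (fun _ => Fin.elim0) (fun _ => Fin.elim0)
      fun i j k => ?_
    simp [arrPow]
  | succ l ih =>
    refine (arrPow_add t (k * l) k).trans (ArrRestricts.trans ?_ (arrKron_arrPow s l 1))
    exact ArrRestricts.kron ih (h.trans (restricts_arrPow_one s))

theorem arrUnit_restricts_of_injective {ι κ : Type*} [DecidableEq ι] [DecidableEq κ] [Fintype ι]
    {f : κ → ι} (hf : Function.Injective f) : ArrRestricts (arrUnit K ι) (arrUnit K κ) :=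
  ArrRestricts.of_eq f f f fun i j k => by simp [arrUnit, hf.eq_iff]

theorem arrUnit_restricts_of_card_le {ι κ : Type*} [DecidableEq ι] [DecidableEq κ] [Fintype ι]
    [Fintype κ] (h : Fintype.card κ ≤ Fintype.card ι) :
    ArrRestricts (arrUnit K ι) (arrUnit K κ) := by
  obtain ⟨f⟩ := Function.Embedding.nonempty_of_card_le h
  exact arrUnit_restricts_of_injective f.injective

end PowUnit

/-! ### Extension of scalars and descent -/

section BaseChange

variable {K E α β γ : Type*} [Field K] [Field E] [Algebra K E] [Fintype α] [Fintype β] [Fintype γ]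

/-- Extension of scalars of an array. -/
def arrBaseChange (E : Type*) [Field E] [Algebra K E] (t : α → β → γ → K) (i : α) (j : β) (k : γ) :
    E :=
  algebraMap K E (t i j k)

theorem ArrRestricts.baseChange {t : α → β → γ → K} {α' β' γ' : Type*} {s : α' → β' → γ' → K}
    (h : ArrRestricts t s) : ArrRestricts (arrBaseChange E t) (arrBaseChange E s) := by
  obtain ⟨A, B, C, h⟩ := h
  exact ⟨fun i x => algebraMap K E (A i x), fun i x => algebraMap K E (B i x),
    fun i x => algebraMap K E (C i x), fun i j k => by simp [arrBaseChange, h]⟩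

omit [Fintype α] [Fintype β] [Fintype γ] in
theorem arrBaseChange_arrPow (t : α → β → γ → K) (N : ℕ) :
    arrBaseChange E (arrPow t N) = arrPow (arrBaseChange E t) N := by
  ext i j k
  simp [arrBaseChange, arrPow]

theorem arrBaseChange_arrUnit (ι : Type*) [DecidableEq ι] :
    arrBaseChange E (arrUnit K ι) = arrUnit E ι := by
  ext i j k
  simp [arrBaseChange, arrUnit, apply_ite]

theorem arrBaseChange_pencil (m : Matrix (Fin 2) (Fin 2) K) :
    arrBaseChange E (pencil m) = pencil (m.map (algebraMap K E)) := by
  ext i j k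
  fin_cases k <;> simp [arrBaseChange, pencil, Matrix.one_apply, apply_ite]

/-- Apply a `K`-linear retraction `l : E → K` to a restriction over `E`. What appears is `t`
multiplied by the trilinear form `l (a * b * c)` on `E`, and that form is a restriction of a unit
array with one entry for each triple of basis vectors. -/
theorem restricts_of_baseChange [FiniteDimensional K E] {t : α → β → γ → K} {ι : Type*}
    [DecidableEq ι] (h : ArrRestricts (arrBaseChange E t) (arrUnit E ι)) :
    ArrRestricts (arrKron t (arrUnit K (Fin (finrank K E) × Fin (finrank K E) ×
      Fin (finrank K E)))) (arrUnit K ι) := by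
  obtain ⟨A, B, C, h⟩ := h
  obtain ⟨l, hl⟩ := LinearMap.exists_leftInverse_of_injective (Algebra.linearMap K E)
    (LinearMap.ker_eq_bot.2 (algebraMap K E).injective)
  have hl' : ∀ r : K, l (algebraMap K E r) = r := fun r => congrArg (fun f => f r) hl
  let e := finBasis K E
  let T : E →ₗ[K] E →ₗ[K] E →ₗ[K] K := (LinearMap.mul K E).compr₂ ((LinearMap.mul K E).compr₂ l)
  have hT : ∀ a b c, T a b c = l (a * b * c) := fun a b c => rfl
  refine ⟨fun i x => e.repr (A i x.1) x.2.1, fun j y => e.repr (B j y.1) y.2.2.1,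
    fun k z => e.repr (C k z.1) z.2.2.2 * T (e z.2.1) (e z.2.2.1) (e z.2.2.2), fun i j k => ?_⟩
  have hLHS : arrUnit K ι i j k = ∑ x, ∑ y, ∑ z, T (A i x) (B j y) (C k z) * t x y z := by
    rw [← hl' (arrUnit K ι i j k)]
    have := h i j k
    rw [← arrBaseChange_arrUnit (K := K)] at this
    rw [arrBaseChange] at this
    rw [this, map_sum]
    refine Finset.sum_congr rfl fun x _ => ?_
    rw [map_sum]
    refine Finset.sum_congr rfl fun y _ => ?_
    rw [map_sum]
    refine Finset.sum_congr rfl fun z _ => ?_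
    rw [hT, arrBaseChange, mul_comm, ← Algebra.smul_def, map_smul, smul_eq_mul, mul_comm]
  rw [hLHS]
  simp only [Fintype.sum_prod_type (α₁ := α), Fintype.sum_prod_type (α₁ := β),
    Fintype.sum_prod_type (α₁ := γ)]
  refine Finset.sum_congr rfl fun x _ => ?_
  conv_rhs => rw [Finset.sum_comm]
  refine Finset.sum_congr rfl fun y _ => ?_
  have : ∀ f : (Fin (finrank K E) × Fin (finrank K E) × Fin (finrank K E)) →
      (Fin (finrank K E) × Fin (finrank K E) × Fin (finrank K E)) → γ →
      (Fin (finrank K E) × Fin (finrank K E) × Fin (finrank K E)) → K,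
      (∑ u, ∑ v, ∑ z, ∑ w, f u v z w * arrUnit K (Fin (finrank K E) × Fin (finrank K E) ×
        Fin (finrank K E)) u v w) = ∑ z, ∑ u, f u u z u := by
    intro f
    conv_rhs => rw [Finset.sum_comm]
    refine Finset.sum_congr rfl fun u _ => ?_
    rw [Finset.sum_comm]
    refine Finset.sum_congr rfl fun z _ => ?_
    simp [arrUnit, ite_and]
  have h2 := this fun u v z w => e.repr (A i x) u.1 * e.repr (B j y) v.2.1 *
    (e.repr (C k z) w.2.2 * T (e w.1) (e w.2.1) (e w.2.2)) * t x y z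
  simp only [arrKron, ← mul_assoc] at h2 ⊢
  rw [h2]
  refine Finset.sum_congr rfl fun z _ => ?_
  rw [form_eq_sum_basis T e e e, sum_triple, Finset.sum_mul]

/-- The auxiliary unit array has fixed size `d`. It sits inside `d` blocks of `k` further copies of
`t`, since each block yields a unit array of size two and `d ≤ 2 ^ d`. -/
theorem exists_shift_of_baseChange [FiniteDimensional K E] {t : α → β → γ → K} {k : ℕ}
    (h : ArrRestricts (arrPow t k) (arrUnit K (Fin 2))) :
    ∃ k₀, ∀ N r, ArrRestricts (arrPow (arrBaseChange E t) N) (arrUnit E (Fin r)) →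
      ArrRestricts (arrPow t (N + k₀)) (arrUnit K (Fin r)) := by
  set d := Fintype.card (Fin (finrank K E) × Fin (finrank K E) × Fin (finrank K E)) with hd
  refine ⟨k * d, fun N r hr => ?_⟩
  rw [← arrBaseChange_arrPow] at hr
  refine (arrPow_add t N (k * d)).trans (ArrRestricts.trans ?_ (restricts_of_baseChange hr))
  refine ArrRestricts.kron (ArrRestricts.refl _) ((h.pow_mul d).trans ?_)
  rw [arrPow_arrUnit]
  refine arrUnit_restricts_of_card_le ?_
  rw [← hd]
  simpa using Nat.lt_two_pow_self.le

end BaseChange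

theorem det_sub_smul_of_eval_charpoly_eq_zero {K : Type*} [Field K]
    {m : Matrix (Fin 2) (Fin 2) K} {μ : K} (h : m.charpoly.eval μ = 0) :
    (m - μ • (1 : Matrix (Fin 2) (Fin 2) K)).det = 0 := by
  rw [Matrix.charpoly_fin_two, Matrix.det_fin_two, Matrix.trace_fin_two] at h
  rw [Matrix.det_fin_two]
  simp at h ⊢
  linear_combination h

/-- Over a finite extension a nonscalar pencil contains a unit array or becomes the `W`-array. -/
theorem exists_extension_dichotomy {K : Type*} [Field K] {m : Matrix (Fin 2) (Fin 2) K}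
    (hm : IsNonscalar m) :
    let E := m.charpoly.SplittingField
    ArrRestricts (arrBaseChange E (pencil m)) (arrUnit E (Fin 2)) ∨
      (ArrRestricts (arrBaseChange E (pencil m)) (wArr E) ∧
        ArrRestricts (wArr E) (arrBaseChange E (pencil m))) := by
  intro E
  obtain ⟨μ, hμ⟩ := (Polynomial.SplittingField.splits m.charpoly).exists_eval_eq_zero (by
    rw [Polynomial.degree_map, Matrix.charpoly_degree_eq_dim]; simp)
  rw [arrBaseChange_pencil]
  refine pencil_dichotomy (μ := μ) ?_ ?_
  · simpa [IsNonscalar] using hm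
  · exact det_sub_smul_of_eval_charpoly_eq_zero (by rwa [Matrix.charpoly_map])

/-! ### Upper bound by covering the support -/

section SupportBound

variable {K : Type*} [Field K]

/-- A subspace of dimension `d` of a coordinate space contains a vector with `d` nonzero entries. -/
theorem exists_mem_finrank_le_card_support {ι : Type*} [Fintype ι] [DecidableEq K]
    (V : Submodule K (ι → K)) :
    ∃ f ∈ V, finrank K V ≤ (Finset.univ.filter fun i => f i ≠ 0).card := by
  classical
  obtain ⟨f, hf⟩ : ∃ f : V, ∀ g : V, (Finset.univ.filter fun i => (g : ι → K) i ≠ 0).card ≤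
      (Finset.univ.filter fun i => (f : ι → K) i ≠ 0).card := by
    have hb : BddAbove (Set.range fun g : V =>
        (Finset.univ.filter fun i => (g : ι → K) i ≠ 0).card) :=
      ⟨Fintype.card ι, by rintro _ ⟨g, rfl⟩; exact Finset.card_le_univ _⟩
    obtain ⟨f, hf⟩ := Nat.sSup_mem (Set.range_nonempty _) hb
    exact ⟨f, fun g => (le_csSup hb ⟨g, rfl⟩).trans_eq hf.symm⟩
  refine ⟨f, f.2, ?_⟩
  -- Take a vector of maximal support. If that support is smaller than the dimension, some nonzero
  -- `g` vanishes on it, and `f + g` has larger support; disjointness rules out cancellation even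
  -- over small fields.
  by_contra! hlt
  set S := Finset.univ.filter fun i => (f : ι → K) i ≠ 0 with hS
  let φ : V →ₗ[K] (S → K) := LinearMap.pi fun s => LinearMap.proj (s : ι) ∘ₗ V.subtype
  obtain ⟨g, hg, hg0⟩ : ∃ g, g ∈ LinearMap.ker φ ∧ g ≠ 0 := by
    by_contra! hcon
    have hinj : Function.Injective φ := by
      rw [injective_iff_map_eq_zero]
      exact fun g hg => hcon g hg
    have := LinearMap.finrank_le_finrank_of_injective hinj
    simp at this
    omega
  have hgS : ∀ i ∈ S, (g : ι → K) i = 0 := fun i hi => congrFun hg ⟨i, hi⟩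
  obtain ⟨i, hi⟩ : ∃ i, (g : ι → K) i ≠ 0 := by
    by_contra! hcon
    exact hg0 (Subtype.ext (funext hcon))
  have hiS : i ∉ S := fun h => hi (hgS i h)
  have : insert i S ⊆ Finset.univ.filter fun j => ((f + g : V) : ι → K) j ≠ 0 := by
    intro j hj
    rw [Finset.mem_insert] at hj
    simp only [Finset.mem_filter, Finset.mem_univ, true_and, Submodule.coe_add, Pi.add_apply]
    rcases hj with rfl | hj
    · have : (f : ι → K) j = 0 := by simpa [hS] using hiS
      rwa [this, zero_add]
    · rw [hgS j hj, add_zero]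
      simpa [hS] using hj
  have h1 := Finset.card_le_card this
  rw [Finset.card_insert_of_notMem hiS] at h1
  have h2 := hf (f + g)
  omega

theorem matrix_rank_add_le {m n : Type*} [Finite m] [Fintype n] (M N : Matrix m n K) :
    (M + N).rank ≤ M.rank + N.rank := by
  rw [Matrix.rank, Matrix.rank, Matrix.rank, Matrix.mulVecLin_add]
  have h : LinearMap.range (M.mulVecLin + N.mulVecLin) ≤
      LinearMap.range M.mulVecLin ⊔ LinearMap.range N.mulVecLin := by
    rintro _ ⟨x, rfl⟩
    exact Submodule.add_mem_sup ⟨x, rfl⟩ ⟨x, rfl⟩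
  exact (Submodule.finrank_mono h).trans (Submodule.finrank_add_le_finrank_add_finrank _ _)

/-- If the support of `t` is covered by slices in `S₁`, `S₂`, `S₃`, then the size of a unit array
restricted from `t` is bounded by the number of these slices. -/
theorem card_le_of_support_cover {α β γ : Type*} [Fintype α] [Fintype β] [Fintype γ]
    {t : α → β → γ → K} {S₁ : Finset α} {S₂ : Finset β} {S₃ : Finset γ}
    (hcov : ∀ x y z, t x y z ≠ 0 → x ∈ S₁ ∨ y ∈ S₂ ∨ z ∈ S₃) {r : ℕ}
    (h : ArrRestricts t (arrUnit K (Fin r))) : r ≤ S₁.card + S₂.card + S₃.card := by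
  classical
  obtain ⟨A, B, C, h⟩ := h
  -- Contract the first leg with a vector `f` that kills the slices in `S₁` and has at least `r -
  -- S₁.card` nonzero entries. The unit array becomes `diagonal f`, while what survives of `t` lives
  -- in the rows `S₂` and columns `S₃`, which bounds the rank.
  let φ : (Fin r → K) →ₗ[K] (S₁ → K) :=
    LinearMap.pi fun x => ∑ p, A p x • (LinearMap.proj p : (Fin r → K) →ₗ[K] K)
  obtain ⟨f, hf, hcard⟩ := exists_mem_finrank_le_card_support (LinearMap.ker φ)
  have hdim : r ≤ finrank K (LinearMap.ker φ) + S₁.card := by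
    have h1 := LinearMap.finrank_range_add_finrank_ker φ
    have h2 := Submodule.finrank_le (LinearMap.range φ)
    simp at h1 h2
    omega
  set F : α → K := fun x => ∑ p, A p x * f p with hF
  have hF0 : ∀ x ∈ S₁, F x = 0 := fun x hx => by
    have := congrFun (LinearMap.mem_ker.1 hf) ⟨x, hx⟩
    simpa [φ, hF] using this
  let M₁ : Matrix (Fin r) S₂ K := fun q y => B q y
  let M₂ : Matrix S₂ (Fin r) K := fun y s => ∑ x, ∑ z, F x * C s z * t x y z
  let M₃ : Matrix (Fin r) S₃ K := fun q z => ∑ x, ∑ y ∈ S₂ᶜ, F x * B q y * t x y z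
  let M₄ : Matrix S₃ (Fin r) K := fun z s => C s z
  have hD : Matrix.diagonal f = M₁ * M₂ + M₃ * M₄ := by
    ext q s
    have e1 : Matrix.diagonal f q s = ∑ x, ∑ y, ∑ z, F x * B q y * C s z * t x y z := by
      have : Matrix.diagonal f q s = ∑ p, f p * arrUnit K (Fin r) p q s := by
        rw [Finset.sum_eq_single q]
        · by_cases hqs : q = s <;> simp [arrUnit, hqs]
        · intro b _ hb
          simp [arrUnit, hb]
        · simp
      rw [this]
      simp_rw [h, sum_triple, Finset.mul_sum]
      rw [Finset.sum_comm]
      refine Finset.sum_congr rfl fun p _ => ?_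
      simp only [hF, Finset.sum_mul]
      refine Finset.sum_congr rfl fun q _ => by ring
    have e2 : (M₁ * M₂) q s = ∑ x, ∑ y ∈ S₂, ∑ z, F x * B q y * C s z * t x y z := by
      rw [Matrix.mul_apply, Finset.sum_coe_sort S₂ (fun y => B q y * ∑ x, ∑ z,
        F x * C s z * t x y z), Finset.sum_comm]
      refine Finset.sum_congr rfl fun y _ => ?_
      rw [Finset.mul_sum]
      refine Finset.sum_congr rfl fun x _ => ?_
      rw [Finset.mul_sum]
      refine Finset.sum_congr rfl fun z _ => by ring
    have e3 : (M₃ * M₄) q s = ∑ x, ∑ y ∈ S₂ᶜ, ∑ z ∈ S₃, F x * B q y * C s z * t x y z := by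
      rw [Matrix.mul_apply, Finset.sum_coe_sort S₃ (fun z => (∑ x, ∑ y ∈ S₂ᶜ,
        F x * B q y * t x y z) * C s z)]
      simp_rw [Finset.sum_mul]
      rw [Finset.sum_comm]
      refine Finset.sum_congr rfl fun x _ => ?_
      rw [Finset.sum_comm]
      refine Finset.sum_congr rfl fun y _ => Finset.sum_congr rfl fun z _ => by ring
    rw [Matrix.add_apply, e1, e2, e3, ← Finset.sum_add_distrib]
    refine Finset.sum_congr rfl fun x _ => ?_
    rw [← Finset.sum_add_sum_compl S₂]
    congr 1
    refine Finset.sum_congr rfl fun y hy => ?_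
    refine (Finset.sum_subset (Finset.subset_univ _) fun z _ hz => ?_).symm
    by_cases hx : x ∈ S₁
    · simp [hF0 x hx]
    · have : t x y z = 0 := by
        by_contra hne
        have := hcov x y z hne
        simp_all
      simp [this]
  have hrank : (Matrix.diagonal f).rank ≤ S₂.card + S₃.card := by
    rw [hD]
    refine (matrix_rank_add_le _ _).trans (add_le_add ?_ ?_)
    · exact (Matrix.rank_mul_le_left _ _).trans ((Matrix.rank_le_card_width _).trans (by simp))
    · exact (Matrix.rank_mul_le_left _ _).trans ((Matrix.rank_le_card_width _).trans (by simp))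
  rw [Matrix.rank_diagonal, Fintype.card_subtype] at hrank
  omega

end SupportBound

/-! ### Upper bound for the `W`-tensor -/

section WUpper

/-- The words of weight at most `N / 3`. -/
def lightWords (N : ℕ) : Finset (Fin N → Fin 2) :=
  Finset.univ.filter fun i => 3 * ∑ t, (i t : ℕ) ≤ N

/-- A Chernoff bound: `2 ^ (N / 3) * (1 / 2) ^ weight` is at least one on light words, and its sum
over all words is `(2 ^ (1 / 3) * 3 / 2) ^ N`. -/
theorem card_lightWords_le (N : ℕ) :
    ((lightWords N).card : ℝ) ≤ (3 / (2 : ℝ) ^ ((2 : ℝ) / 3)) ^ N := by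
  have h1 : ((lightWords N).card : ℝ) ≤
      ∑ i : Fin N → Fin 2, (2 : ℝ) ^ ((N : ℝ) / 3) * ∏ t, (1 / 2 : ℝ) ^ (i t : ℕ) := by
    rw [← nsmul_one, ← Finset.sum_const]
    refine (Finset.sum_le_sum fun i hi => ?_).trans
      (Finset.sum_le_sum_of_subset_of_nonneg (Finset.subset_univ (lightWords N))
        fun i _ _ => by positivity)
    rw [Finset.prod_pow_eq_pow_sum, one_div, inv_pow, ← div_eq_mul_inv, one_le_div (by positivity),
      ← Real.rpow_natCast]
    refine Real.rpow_le_rpow_of_exponent_le (by norm_num) ?_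
    have : 3 * ∑ t, (i t : ℕ) ≤ N := by simpa [lightWords] using hi
    rw [le_div_iff₀ (by norm_num)]
    exact_mod_cast (by omega)
  refine h1.trans_eq ?_
  have h2 := Finset.prod_univ_sum (fun _ : Fin N => (Finset.univ : Finset (Fin 2)))
    (fun _ (a : Fin 2) => (1 / 2 : ℝ) ^ (a : ℕ))
  rw [Fintype.piFinset_univ] at h2
  rw [← Finset.mul_sum, ← h2]
  simp only [Fin.sum_univ_two, Finset.prod_const, Finset.card_univ, Fintype.card_fin]
  rw [show (N : ℝ) / 3 = (1 / 3 : ℝ) * N by ring, Real.rpow_mul_natCast (by norm_num), ← mul_pow]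
  congr 1
  have : (2 : ℝ) ^ ((1 : ℝ) / 3) * (2 : ℝ) ^ ((2 : ℝ) / 3) = 2 := by
    rw [← Real.rpow_add (by norm_num)]
    norm_num
  rw [eq_div_iff (by positivity)]
  simp only [Fin.val_zero, pow_zero, Fin.val_one, pow_one]
  linear_combination (3 / 2 : ℝ) * this

/-- On the support exactly one leg carries a one at each place. The three weights add up to `N`, so
one of the words is light. -/
theorem le_of_wArr_pow_restricts {K : Type*} [Field K] {N r : ℕ}
    (h : ArrRestricts (arrPow (wArr K) N) (arrUnit K (Fin r))) :
    (r : ℝ) ≤ 3 * (3 / (2 : ℝ) ^ ((2 : ℝ) / 3)) ^ N := by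
  have := card_le_of_support_cover (S₁ := lightWords N) (S₂ := lightWords N) (S₃ := lightWords N)
    (fun x y z hne => ?_) h
  · have h2 := card_lightWords_le N
    have h3 : (r : ℝ) ≤ 3 * (lightWords N).card := by exact_mod_cast (by omega)
    linarith
  · have hsum : ∑ t, (x t : ℕ) + ∑ t, (y t : ℕ) + ∑ t, (z t : ℕ) = N := by
      rw [← Finset.sum_add_distrib, ← Finset.sum_add_distrib]
      have : ∀ t, (x t : ℕ) + y t + z t = 1 := fun t => by
        have := Finset.prod_ne_zero_iff.1 hne t (Finset.mem_univ t)
        by_contra hcon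
        exact this (by simp [wArr, hcon])
      simp [this]
    simp only [lightWords, Finset.mem_filter, Finset.mem_univ, true_and]
    omega

end WUpper

/-! ### Hashing support words into a progression-free set -/

section Hashing

/-- Two words in the letters `0, 1, 2` use the letter `a` in the same places. -/
def Agree {N : ℕ} (a : Fin 3) (w w' : Fin N → Fin 3) : Prop := ∀ t, w t = a ↔ w' t = a

instance {N : ℕ} (a : Fin 3) (w w' : Fin N → Fin 3) : Decidable (Agree a w w') := by
  unfold Agree; infer_instance

/-- The sum of a weight function over the places of the letter `a`. -/
def letterSum {N M : ℕ} (φ : Fin N → ZMod M) (a : Fin 3) (w : Fin N → Fin 3) : ZMod M :=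
  ∑ t, if w t = a then φ t else 0

variable {N M : ℕ}

theorem letterSum_congr {φ : Fin N → ZMod M} {a : Fin 3} {w w' : Fin N → Fin 3}
    (h : Agree a w w') : letterSum φ a w = letterSum φ a w' := by
  unfold letterSum
  refine Finset.sum_congr rfl fun t _ => ?_
  simp [h t]

theorem letterSum_add (φ : Fin N → ZMod M) (w : Fin N → Fin 3) :
    letterSum φ 0 w + letterSum φ 1 w + letterSum φ 2 w = ∑ t, φ t := by
  unfold letterSum
  rw [← Finset.sum_add_distrib, ← Finset.sum_add_distrib]
  refine Finset.sum_congr rfl fun t _ => ?_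
  generalize w t = x
  fin_cases x <;> simp

theorem eq_of_agree {w w' : Fin N → Fin 3} (h0 : Agree 0 w w') (h1 : Agree 1 w w') : w = w' := by
  funext t
  have := h0 t
  have := h1 t
  generalize w t = x at *
  generalize w' t = y at *
  fin_cases x <;> fin_cases y <;> simp_all

/-- The words whose two hash values agree and lie in `S`. -/
def hashKept (S : Finset (ZMod M)) (Φ : Finset (Fin N → Fin 3))
    (h : (Fin N → ZMod M) × ZMod M × ZMod M) : Finset (Fin N → Fin 3) :=
  Φ.filter fun w => h.2.1 + letterSum h.1 0 w ∈ S ∧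
    h.2.2 + letterSum h.1 1 w = h.2.1 + letterSum h.1 0 w

/-- The kept words which share no letter class with another kept word. -/
def hashIsolated (S : Finset (ZMod M)) (Φ : Finset (Fin N → Fin 3))
    (h : (Fin N → ZMod M) × ZMod M × ZMod M) : Finset (Fin N → Fin 3) :=
  (hashKept S Φ h).filter fun w => ∀ w' ∈ hashKept S Φ h, (∃ a, Agree a w w') → w' = w

variable {S : Finset (ZMod M)} {Φ : Finset (Fin N → Fin 3)}

/-- The two hash values of `x` are inherited from `u` and `v`, and their sum is twice the value of
`w`, because the third letter sum is inherited from `w`. Progression-freeness makes all three equal,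
so `x` is kept; sharing a letter class with each isolated word, it equals each of them. -/
theorem hashIsolated_induced (hS : ∀ x ∈ S, ∀ y ∈ S, ∀ z ∈ S, x + y = z + z → x = z)
    {h : (Fin N → ZMod M) × ZMod M × ZMod M} {u v w x : Fin N → Fin 3} (hx : x ∈ Φ)
    (hu : u ∈ hashIsolated S Φ h) (hv : v ∈ hashIsolated S Φ h) (hw : w ∈ hashIsolated S Φ h)
    (h0 : Agree 0 u x) (h1 : Agree 1 v x) (h2 : Agree 2 w x) : u = v ∧ v = w := by
  simp only [hashIsolated, Finset.mem_filter] at hu hv hw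
  have hxK : x ∈ hashKept S Φ h := by
    have ku := hu.1
    have kv := hv.1
    have kw := hw.1
    simp only [hashKept, Finset.mem_filter] at ku kv kw ⊢
    have e2 := letterSum_add h.1 w
    have e2' := letterSum_add h.1 x
    rw [letterSum_congr h2] at e2
    rw [letterSum_congr h0] at ku
    have kv1 := kv.2.1
    have kv2 := kv.2.2
    rw [← kv2, letterSum_congr h1] at kv1
    have hsum : (h.2.1 + letterSum h.1 0 x) + (h.2.2 + letterSum h.1 1 x) =
        (h.2.1 + letterSum h.1 0 w) + (h.2.1 + letterSum h.1 0 w) := by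
      linear_combination e2' - e2 + kw.2.2
    refine ⟨hx, ku.2.1, ?_⟩
    rw [hS _ ku.2.1 _ kv1 _ kw.2.1 hsum]
    exact hS _ kv1 _ ku.2.1 _ kw.2.1 (by rw [← hsum, add_comm])
  have eu := hu.2 x hxK ⟨0, h0⟩
  have ev := hv.2 x hxK ⟨1, h1⟩
  have ew := hw.2 x hxK ⟨2, h2⟩
  exact ⟨eu.symm.trans ev, ev.symm.trans ew⟩

theorem letterSum_add_single [NeZero M] {φ : Fin N → ZMod M} {a : Fin 3} {w : Fin N → Fin 3}
    (t : Fin N) (c : ZMod M) :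
    letterSum (φ + Pi.single t c) a w = letterSum φ a w + if w t = a then c else 0 := by
  unfold letterSum
  have : ∀ s, (if w s = a then (φ + Pi.single t c : Fin N → ZMod M) s else 0) =
      (if w s = a then φ s else 0) + if s = t then (if w t = a then c else 0) else 0 := by
    intro s
    by_cases hs : s = t
    · subst hs
      by_cases hw : w s = a <;> simp [hw]
    · by_cases hw : w s = a <;> simp [hw, hs]
  simp_rw [this]
  rw [Finset.sum_add_distrib]
  simp

/-- Given the weights and a target in `S`, the two shifts that send both hash values to it are
determined. -/
theorem card_hash_keeping [NeZero M] {w : Fin N → Fin 3} (hw : w ∈ Φ) :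
    S.card * M ^ N ≤ (Finset.univ.filter fun h : (Fin N → ZMod M) × ZMod M × ZMod M =>
      w ∈ hashKept S Φ h).card := by
  have : (S ×ˢ (Finset.univ : Finset (Fin N → ZMod M))).card = S.card * M ^ N := by
    simp [Finset.card_product, ZMod.card]
  rw [← this]
  refine Finset.card_le_card_of_injOn
    (fun p => (p.2, p.1 - letterSum p.2 0 w, p.1 - letterSum p.2 1 w)) ?_ ?_
  · rintro ⟨s, φ⟩ hp
    simp only [Finset.coe_product, Set.mem_prod, Finset.mem_coe] at hp
    simpa [hashKept, hw] using hp.1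
  · rintro ⟨s, φ⟩ - ⟨s', φ'⟩ - heq
    simp only [Prod.mk.injEq] at heq
    obtain ⟨rfl, h1, -⟩ := heq
    simpa using h1

/-- Two kept words sharing a letter class have the same letter sums. At a place where they differ,
changing the weight by `c` separates these sums by `±c`, so the `M` changes have disjoint effects;
this saves a factor `M` over keeping a single word. -/
theorem card_hash_conflict [NeZero M]
    (hS : ∀ x ∈ S, ∀ y ∈ S, ∀ z ∈ S, x + y = z + z → x = z)
    {w w' : Fin N → Fin 3} (hne : w' ≠ w) {a : Fin 3} (ha : Agree a w w') :
    (Finset.univ.filter fun h : (Fin N → ZMod M) × ZMod M × ZMod M =>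
      w ∈ hashKept S Φ h ∧ w' ∈ hashKept S Φ h).card * M ≤ S.card * M ^ N := by
  have key : ∀ h : (Fin N → ZMod M) × ZMod M × ZMod M, w ∈ hashKept S Φ h →
      w' ∈ hashKept S Φ h → letterSum h.1 0 w = letterSum h.1 0 w' ∧
        letterSum h.1 1 w = letterSum h.1 1 w' := by
    intro h k k'
    simp only [hashKept, Finset.mem_filter] at k k'
    obtain ⟨-, k1, k2⟩ := k
    obtain ⟨-, k1', k2'⟩ := k'
    suffices H : h.2.1 + letterSum h.1 0 w = h.2.1 + letterSum h.1 0 w' by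
      refine ⟨add_left_cancel H, ?_⟩
      rw [H, ← k2'] at k2
      exact add_left_cancel k2
    have := letterSum_congr (φ := h.1) ha
    fin_cases a
    · simpa using this
    · simp only [Fin.mk_one, Fin.isValue] at this
      rw [← k2, ← k2', this]
    -- Here only twice the hash values are known to agree. The modulus may be even, so
    -- progression-freeness replaces division by two.
    · refine hS _ k1 _ k1 _ k1' ?_
      have e2 := letterSum_add h.1 w
      have e2' := letterSum_add h.1 w'
      simp only [Fin.reduceFinMk] at this
      linear_combination e2 - e2' - this + k2' - k2
  obtain ⟨b, t, hb, ht⟩ : ∃ (b : Fin 3) (t : Fin N), (b = 0 ∨ b = 1) ∧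
      ¬ (w t = b ↔ w' t = b) := by
    by_contra! hcon
    refine hne (eq_of_agree (fun t => ?_) fun t => ?_)
    · exact (hcon 0 t (Or.inl rfl)).symm
    · exact (hcon 1 t (Or.inr rfl)).symm
  have hcard : (S ×ˢ (Finset.univ : Finset (Fin N → ZMod M))).card = S.card * M ^ N := by
    simp [Finset.card_product, ZMod.card]
  have hcard' : ((Finset.univ.filter fun h : (Fin N → ZMod M) × ZMod M × ZMod M =>
      w ∈ hashKept S Φ h ∧ w' ∈ hashKept S Φ h) ×ˢ (Finset.univ : Finset (ZMod M))).card =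
      (Finset.univ.filter fun h : (Fin N → ZMod M) × ZMod M × ZMod M =>
      w ∈ hashKept S Φ h ∧ w' ∈ hashKept S Φ h).card * M := by
    rw [Finset.card_product, Finset.card_univ, ZMod.card]
  rw [← hcard, ← hcard']
  refine Finset.card_le_card_of_injOn
    (fun p => (p.1.2.1 + letterSum p.1.1 0 w, p.1.1 + Pi.single t p.2)) ?_ ?_
  · rintro ⟨h, c⟩ hp
    simp only [Finset.coe_product, Set.mem_prod, Finset.mem_coe, Finset.mem_filter,
      hashKept] at hp
    simpa using hp.1.2.1.2.1
  · rintro ⟨⟨φ, α, β⟩, c⟩ hp ⟨⟨φ', α', β'⟩, c'⟩ hp' heq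
    simp only [Finset.coe_product, Set.mem_prod, Finset.mem_coe, Finset.mem_filter,
      Finset.mem_univ, true_and, and_true] at hp hp'
    simp only [Prod.mk.injEq] at heq
    obtain ⟨e1, e2⟩ := heq
    have l : letterSum φ b w = letterSum φ b w' := by
      rcases hb with rfl | rfl
      exacts [(key _ hp.1 hp.2).1, (key _ hp.1 hp.2).2]
    have l' : letterSum φ' b w = letterSum φ' b w' := by
      rcases hb with rfl | rfl
      exacts [(key _ hp'.1 hp'.2).1, (key _ hp'.1 hp'.2).2]
    have m1 := letterSum_add_single (φ := φ) (a := b) (w := w) t c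
    have m1' := letterSum_add_single (φ := φ) (a := b) (w := w') t c
    have m2 := letterSum_add_single (φ := φ') (a := b) (w := w) t c'
    have m2' := letterSum_add_single (φ := φ') (a := b) (w := w') t c'
    rw [e2] at m1 m1'
    have hc : c = c' := by
      by_cases hwt : w t = b <;> by_cases hwt' : w' t = b
      · simp [hwt, hwt'] at ht
      · simp only [hwt, hwt', if_true, if_false, add_zero] at m1 m1' m2 m2'
        linear_combination -m1 + m2 + m1' - m2' - l + l'
      · simp only [hwt, hwt', if_true, if_false, add_zero] at m1 m1' m2 m2'
        linear_combination m1 - m2 - m1' + m2' + l - l'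
      · simp [hwt, hwt'] at ht
    subst hc
    have hφ : φ = φ' := add_right_cancel e2
    subst hφ
    have hα : α = α' := add_right_cancel e1
    subst hα
    have k := hp.1
    have k' := hp'.1
    simp only [hashKept, Finset.mem_filter] at k k'
    have hβ : β = β' := add_right_cancel (k.2.2.trans k'.2.2.symm)
    rw [hβ]

/-- For some hash function many isolated words are kept. -/
theorem exists_hash [NeZero M] (hS : ∀ x ∈ S, ∀ y ∈ S, ∀ z ∈ S, x + y = z + z → x = z) {D : ℕ}
    (hD : ∀ a, ∀ w ∈ Φ, (Φ.filter fun w' => Agree a w w').card ≤ D) (hM : M = 6 * D) :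
    ∃ h, Φ.card * S.card ≤ 2 * M ^ 2 * (hashIsolated S Φ h).card := by
  by_contra! hcon
  have hMpos : 0 < M := NeZero.pos M
  set H := (Fin N → ZMod M) × ZMod M × ZMod M with hH
  have hHcard : (Finset.univ : Finset H).card = M ^ N * M ^ 2 := by
    rw [Finset.card_univ, Fintype.card_prod, Fintype.card_prod, Fintype.card_fun, ZMod.card,
      Fintype.card_fin, pow_two]
  have hlt : ∑ h : H, 2 * M ^ 2 * (hashIsolated S Φ h).card <
      ∑ _h : H, Φ.card * S.card := by
    refine Finset.sum_lt_sum_of_nonempty ⟨(0, 0, 0), Finset.mem_univ _⟩ fun h _ => hcon h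
  rw [Finset.sum_const, hHcard, ← Finset.mul_sum, smul_eq_mul] at hlt
  have hkept : Φ.card * (S.card * M ^ N) ≤ ∑ h : H, (hashKept S Φ h).card := by
    have e : ∀ h : H, hashKept S Φ h = Φ.bipartiteAbove (fun h w => w ∈ hashKept S Φ h) h := by
      intro h
      ext w
      simp [Finset.bipartiteAbove, hashKept]
    rw [Finset.sum_congr rfl fun h _ => congrArg Finset.card (e h),
      Finset.sum_card_bipartiteAbove_eq_sum_card_bipartiteBelow, ← smul_eq_mul, ← Finset.sum_const]
    refine Finset.sum_le_sum fun w hw => ?_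
    refine (card_hash_keeping (S := S) (M := M) hw).trans (le_of_eq ?_)
    congr 1
  let conf : (Fin N → Fin 3) → Finset (Fin N → Fin 3) := fun w =>
    Φ.filter fun w' => w' ≠ w ∧ ∃ a, Agree a w w'
  have hconf : ∀ w ∈ Φ, (conf w).card ≤ 3 * D := by
    intro w hw
    have hsub : conf w ⊆ (Finset.univ : Finset (Fin 3)).biUnion fun a =>
        Φ.filter fun w' => Agree a w w' := by
      intro w' hw'
      simp only [conf, Finset.mem_filter] at hw'
      obtain ⟨h1, -, a, h2⟩ := hw'
      simp only [Finset.mem_biUnion, Finset.mem_filter, Finset.mem_univ, true_and]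
      exact ⟨a, h1, h2⟩
    refine (Finset.card_le_card hsub).trans (Finset.card_biUnion_le.trans ?_)
    refine (Finset.sum_le_sum fun a _ => hD a w hw).trans ?_
    simp
  have hbad : (∑ h : H, (hashKept S Φ h \ hashIsolated S Φ h).card) * M ≤
      Φ.card * (3 * D * (S.card * M ^ N)) := by
    have e : ∀ h : H, hashKept S Φ h \ hashIsolated S Φ h =
        Φ.bipartiteAbove (fun h w => w ∈ hashKept S Φ h \ hashIsolated S Φ h) h := by
      intro h
      ext w
      simp only [Finset.bipartiteAbove, hashKept, Finset.mem_filter, Finset.mem_sdiff]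
      tauto
    rw [Finset.sum_congr rfl fun h _ => congrArg Finset.card (e h),
      Finset.sum_card_bipartiteAbove_eq_sum_card_bipartiteBelow, Finset.sum_mul, ← smul_eq_mul,
      ← Finset.sum_const]
    refine Finset.sum_le_sum fun w hw => ?_
    have hsub : (Finset.univ : Finset H).bipartiteBelow
        (fun h w => w ∈ hashKept S Φ h \ hashIsolated S Φ h) w ⊆ (conf w).biUnion fun w' =>
          Finset.univ.filter fun h : H => w ∈ hashKept S Φ h ∧ w' ∈ hashKept S Φ h := by
      intro h hh
      simp only [Finset.bipartiteBelow, Finset.mem_filter, Finset.mem_univ, true_and,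
        Finset.mem_sdiff, hashIsolated, not_and, not_forall] at hh
      obtain ⟨h1, h2⟩ := hh
      obtain ⟨w', hw', hag, hne⟩ := h2 h1
      simp only [Finset.mem_biUnion, Finset.mem_filter, Finset.mem_univ, true_and, conf]
      exact ⟨w', ⟨(Finset.mem_filter.1 hw').1, hne, hag⟩, h1, hw'⟩
    refine (Nat.mul_le_mul_right M ((Finset.card_le_card hsub).trans
      Finset.card_biUnion_le)).trans ?_
    rw [Finset.sum_mul]
    refine (Finset.sum_le_sum (g := fun _ => S.card * M ^ N) fun w' hw' => ?_).trans ?_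
    · simp only [conf, Finset.mem_filter] at hw'
      obtain ⟨-, hne, a, hag⟩ := hw'
      exact card_hash_conflict hS hne hag
    · rw [Finset.sum_const, smul_eq_mul]
      exact Nat.mul_le_mul_right _ (hconf w hw)
  have hsplit : ∑ h : H, (hashKept S Φ h).card = ∑ h : H, (hashIsolated S Φ h).card +
      ∑ h : H, (hashKept S Φ h \ hashIsolated S Φ h).card := by
    rw [← Finset.sum_add_distrib]
    refine Finset.sum_congr rfl fun h _ => ?_
    rw [add_comm]
    exact (Finset.card_sdiff_add_card_eq_card (Finset.filter_subset _ _)).symm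
  rw [hsplit] at hkept
  set I := ∑ h : H, (hashIsolated S Φ h).card
  set B := ∑ h : H, (hashKept S Φ h \ hashIsolated S Φ h).card
  set X := Φ.card * (S.card * M ^ N) with hX
  -- Each word has at most `3 * D` conflicts, each costing a factor `M = 6 * D`, so at most half of
  -- the guaranteed total of kept words is spoiled. Averaging over the `M ^ (N + 2)` hash functions
  -- concludes.
  have h1 : 2 * B ≤ X := by
    refine Nat.le_of_mul_le_mul_right (c := M) ?_ hMpos
    calc 2 * B * M = 2 * (B * M) := by ring
      _ ≤ 2 * (Φ.card * (3 * D * (S.card * M ^ N))) := by omega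
      _ = X * (6 * D) := by rw [hX]; ring
      _ = X * M := by rw [← hM]
  have h2 : X ≤ 2 * I := by omega
  have h3 : M ^ N * M ^ 2 * (Φ.card * S.card) = X * M ^ 2 := by rw [hX]; ring
  rw [h3] at hlt
  have h4 := Nat.mul_le_mul_right (M ^ 2) h2
  linarith

end Hashing

/-! ### Lower bound for the `W`-tensor -/

section WLower

/-- The words of length `3 n` using each of the three letters `n` times. -/
def balancedWords (n : ℕ) : Finset (Fin (3 * n) → Fin 3) :=
  Finset.univ.filter fun w => ∀ a, (Finset.univ.filter fun t => w t = a).card = n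

/-- With the places of `a` fixed, a word is determined by which of the remaining `2 * n` places
carry `a + 1`. -/
theorem card_balancedWords_agree_le {n : ℕ} (a : Fin 3) {w : Fin (3 * n) → Fin 3}
    (hw : w ∈ balancedWords n) :
    ((balancedWords n).filter fun w' => Agree a w w').card ≤ 4 ^ n := by
  have hcard : (Finset.univ.filter fun t => w t ≠ a).card = 2 * n := by
    have h1 : (Finset.univ.filter fun t => w t = a).card +
        (Finset.univ.filter fun t => w t ≠ a).card = _ :=
      Finset.card_filter_add_card_filter_not (s := Finset.univ) (fun t => w t = a)
    have h2 : (Finset.univ.filter fun t => w t = a).card = n := by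
      simp only [balancedWords, Finset.mem_filter] at hw
      exact hw.2 a
    rw [h2, Finset.card_univ, Fintype.card_fin] at h1
    omega
  have hpow : (Finset.univ.filter fun t => w t ≠ a).powerset.card = 4 ^ n := by
    rw [Finset.card_powerset, hcard, pow_mul]
    norm_num
  rw [← hpow]
  refine Finset.card_le_card_of_injOn (fun w' => Finset.univ.filter fun t => w' t = a + 1) ?_ ?_
  · intro w' hw'
    simp only [Finset.coe_filter, Set.mem_ofPred_eq] at hw'
    simp only [Finset.coe_powerset, Set.mem_preimage, Set.mem_powerset_iff, Finset.coe_subset]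
    intro t ht
    simp only [Finset.mem_filter, Finset.mem_univ, true_and] at ht ⊢
    rw [Ne, hw'.2 t, ht]
    fin_cases a <;> decide
  · intro w' hw' w'' hw'' heq
    simp only [Finset.coe_filter, Set.mem_ofPred_eq] at hw' hw''
    funext t
    have e1 : w' t = a ↔ w'' t = a := (hw'.2 t).symm.trans (hw''.2 t)
    have e2 : w' t = a + 1 ↔ w'' t = a + 1 := by simpa using Finset.ext_iff.1 heq t
    have key : ∀ a x y : Fin 3, (x = a ↔ y = a) → (x = a + 1 ↔ y = a + 1) → x = y := by decide
    exact key a _ _ e1 e2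

theorem choose_mul_choose_le_card_balancedWords (n : ℕ) :
    (3 * n).choose n * (2 * n).choose n ≤ (balancedWords n).card := by
  have hcard : ((Finset.univ : Finset (Fin (3 * n))).powersetCard n).sum
      (fun A => (Aᶜ.powersetCard n).card) = (3 * n).choose n * (2 * n).choose n := by
    rw [Finset.sum_congr rfl (g := fun _ => (2 * n).choose n), Finset.sum_const,
      Finset.card_powersetCard, Finset.card_univ, Fintype.card_fin, smul_eq_mul]
    intro A hA
    rw [Finset.card_powersetCard, Finset.card_compl, Fintype.card_fin,
      (Finset.mem_powersetCard.1 hA).2]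
    congr 1
    omega
  rw [← hcard, ← Finset.card_sigma]
  refine Finset.card_le_card_of_injOn
    (fun p t => if t ∈ p.1 then 0 else if t ∈ p.2 then 1 else 2) ?_ ?_
  · rintro ⟨A, B⟩ hAB
    simp only [Finset.coe_sigma, Set.mem_sigma_iff, Finset.mem_coe, Finset.mem_powersetCard] at hAB
    obtain ⟨⟨-, hA⟩, hB, hB'⟩ := hAB
    have hdisj : Disjoint A B := Finset.disjoint_left.2 fun t h1 h2 =>
      Finset.mem_compl.1 (hB h2) h1
    simp only [balancedWords, Finset.coe_filter, Finset.mem_univ, true_and, Set.mem_ofPred_eq]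
    intro a
    fin_cases a
    · refine Eq.trans (congrArg Finset.card ?_) hA
      ext t
      by_cases h1 : t ∈ A <;> by_cases h2 : t ∈ B <;> simp [h1, h2]
    · refine Eq.trans (congrArg Finset.card ?_) hB'
      ext t
      by_cases h1 : t ∈ A <;> by_cases h2 : t ∈ B <;> simp [h1, h2]
      exact Finset.disjoint_left.1 hdisj h1 h2
    · have : (A ∪ B)ᶜ.card = n := by
        rw [Finset.card_compl, Finset.card_union_of_disjoint hdisj, hA, hB', Fintype.card_fin]
        omega
      refine Eq.trans (congrArg Finset.card ?_) this
      ext t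
      by_cases h1 : t ∈ A <;> by_cases h2 : t ∈ B <;> simp [h1, h2]
  · rintro ⟨A, B⟩ hAB ⟨A', B'⟩ hAB' heq
    simp only [Finset.coe_sigma, Set.mem_sigma_iff, Finset.mem_coe, 
      Finset.mem_powersetCard] at hAB hAB'
    obtain ⟨-, hB, -⟩ := hAB
    obtain ⟨-, hB', -⟩ := hAB'
    have key : ∀ t, (t ∈ A ↔ t ∈ A') ∧ (t ∈ B ↔ t ∈ B') := by
      intro t
      have h := congrFun heq t
      have h1 : t ∈ B → t ∉ A := fun ht => Finset.mem_compl.1 (hB ht)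
      have h2 : t ∈ B' → t ∉ A' := fun ht => Finset.mem_compl.1 (hB' ht)
      simp only at h
      by_cases hA : t ∈ A <;> by_cases hA' : t ∈ A' <;> by_cases hb : t ∈ B <;>
        by_cases hb' : t ∈ B' <;> simp_all
    have eA : A = A' := Finset.ext fun t => (key t).1
    have eB : B = B' := Finset.ext fun t => (key t).2
    rw [eA, eB]

/-- Isolated balanced words give a unit array inside the power of the `W`-array. -/
theorem wArr_pow_restricts_of_hash {K : Type*} [Field K] {n M : ℕ} {S : Finset (ZMod M)}
    (hS : ∀ x ∈ S, ∀ y ∈ S, ∀ z ∈ S, x + y = z + z → x = z)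
    (h : (Fin (3 * n) → ZMod M) × ZMod M × ZMod M) :
    ArrRestricts (arrPow (wArr K) (3 * n))
      (arrUnit K (Fin (hashIsolated S (balancedWords n) h).card)) := by
  refine ArrRestricts.trans (S := arrUnit K (hashIsolated S (balancedWords n) h)) ?_
    (arrUnit_restricts_of_card_le (by simp))
  let leg : Fin 3 → hashIsolated S (balancedWords n) h → Fin (3 * n) → Fin 2 :=
    fun a w t => if w.1 t = a then 1 else 0
  refine ArrRestricts.of_eq (leg 0) (leg 1) (leg 2) fun u v w => ?_
  have hleg : ∀ a (w : hashIsolated S (balancedWords n) h) t,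
      ((leg a w t : Fin 2) : ℕ) = if w.1 t = a then 1 else 0 := by
    intro a w t
    by_cases hc : w.1 t = a <;> simp [leg, hc]
  simp only [arrPow, wArr, hleg]
  rw [Finset.prod_ite_zero, Finset.prod_const_one, arrUnit]
  suffices H : (u = v ∧ v = w) ↔ ∀ t ∈ Finset.univ, (if u.1 t = 0 then 1 else 0) +
      (if v.1 t = 1 then 1 else 0) + (if w.1 t = 2 then 1 else 0) = 1 by
    by_cases hc : u = v ∧ v = w
    · rw [if_pos hc, if_pos (H.1 hc)]
    · rw [if_neg hc, if_neg (mt H.2 hc)]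
  refine ⟨?_, fun hsum => ?_⟩
  · rintro ⟨rfl, rfl⟩ t -
    generalize u.1 t = x
    fin_cases x <;> simp
  -- A nonzero entry glues the three legs into one word `x`; each letter count comes from a balanced
  -- word, so `x` is balanced and the isolation argument applies.
  · let x : Fin (3 * n) → Fin 3 := fun t => if u.1 t = 0 then 0 else if v.1 t = 1 then 1 else 2
    have h0 : Agree 0 u.1 x := by
      intro t
      by_cases h1 : u.1 t = 0 <;> by_cases h2 : v.1 t = 1 <;> simp [x, h1, h2]
    have h1 : Agree 1 v.1 x := by
      intro t
      have := hsum t (Finset.mem_univ t)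
      by_cases h1 : u.1 t = 0 <;> by_cases h2 : v.1 t = 1 <;> simp [x, h1, h2] at this ⊢
      omega
    have h2 : Agree 2 w.1 x := by
      intro t
      have := hsum t (Finset.mem_univ t)
      by_cases h1 : u.1 t = 0 <;> by_cases h2 : v.1 t = 1 <;> by_cases h3 : w.1 t = 2 <;>
        simp [x, h1, h2, h3] at this ⊢
    have hbal : ∀ w : hashIsolated S (balancedWords n) h,
        ∀ a, (Finset.univ.filter fun t => w.1 t = a).card = n := by
      intro w
      have hw := w.2
      simp only [hashIsolated, hashKept, balancedWords, Finset.mem_filter, Finset.mem_univ,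
        true_and] at hw
      exact hw.1.1
    have hx : x ∈ balancedWords n := by
      simp only [balancedWords, Finset.mem_filter, Finset.mem_univ, true_and]
      intro a
      fin_cases a
      · exact (congrArg Finset.card (Finset.filter_congr fun t _ => (h0 t).symm)).trans (hbal u 0)
      · exact (congrArg Finset.card (Finset.filter_congr fun t _ => (h1 t).symm)).trans (hbal v 1)
      · exact (congrArg Finset.card (Finset.filter_congr fun t _ => (h2 t).symm)).trans (hbal w 2)
    have := hashIsolated_induced hS hx u.2 v.2 w.2 h0 h1 h2
    exact ⟨Subtype.ext this.1, Subtype.ext this.2⟩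

/-- Modulo `2 * m`, sums of two numbers below `m` do not wrap around. -/
theorem exists_threeAPFree_zmod (m : ℕ) : ∃ S : Finset (ZMod (2 * m)),
    S.card = rothNumberNat m ∧ ∀ x ∈ S, ∀ y ∈ S, ∀ z ∈ S, x + y = z + z → x = z := by
  obtain ⟨t, ht, hcard, hfree⟩ := rothNumberNat_spec m
  have hlt : ∀ x ∈ t, x < m := fun x hx => Finset.mem_range.1 (ht hx)
  refine ⟨t.image (Nat.cast : ℕ → ZMod (2 * m)), ?_, ?_⟩
  · rw [Finset.card_image_of_injOn, hcard]
    intro x hx y hy hxy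
    have h1 := hlt x hx
    have h2 := hlt y hy
    rw [ZMod.natCast_eq_natCast_iff'] at hxy
    rwa [Nat.mod_eq_of_lt (by omega), Nat.mod_eq_of_lt (by omega)] at hxy
  · simp only [Finset.mem_image]
    rintro _ ⟨x, hx, rfl⟩ _ ⟨y, hy, rfl⟩ _ ⟨z, hz, rfl⟩ hxyz
    have h1 := hlt x hx
    have h2 := hlt y hy
    have h3 := hlt z hz
    rw [← Nat.cast_add, ← Nat.cast_add, ZMod.natCast_eq_natCast_iff',
      Nat.mod_eq_of_lt (by omega), Nat.mod_eq_of_lt (by omega)] at hxyz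
    rw [hfree hx hz hy hxyz]

theorem exists_wArr_pow_restricts (K : Type*) [Field K] (n : ℕ) :
    ∃ r, ArrRestricts (arrPow (wArr K) (3 * n)) (arrUnit K (Fin r)) ∧
      (3 * n).choose n * (2 * n).choose n * rothNumberNat (3 * 4 ^ n) ≤
        2 * (6 * 4 ^ n) ^ 2 * r := by
  obtain ⟨S, hcard, hS⟩ := exists_threeAPFree_zmod (3 * 4 ^ n)
  have : NeZero (2 * (3 * 4 ^ n)) := ⟨by positivity⟩
  obtain ⟨h, hh⟩ := exists_hash (Φ := balancedWords n) (D := 4 ^ n) hS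
    (fun a w hw => card_balancedWords_agree_le a hw) (by ring)
  refine ⟨_, wArr_pow_restricts_of_hash hS h, ?_⟩
  rw [hcard] at hh
  refine (Nat.mul_le_mul_right _ (choose_mul_choose_le_card_balancedWords n)).trans
    (hh.trans_eq ?_)
  ring

/-- Consecutive binomials have ratio `3 (3n+2)(3n+1) / ((2n+2)(2n+1))`, slightly below `27 / 4`; the
linear factor makes up the deficit. -/
theorem pow_le_mul_choose_three_mul (n : ℕ) :
    (27 / 4 : ℝ) ^ n ≤ (3 * n + 1) * (3 * n).choose n := by
  induction n with
  | zero => simp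
  | succ n ih =>
    have hf : ∀ n : ℕ, (3 * n).choose n * n.factorial * (2 * n).factorial = (3 * n).factorial := by
      intro n
      have := Nat.choose_mul_factorial_mul_factorial (show n ≤ 3 * n by omega)
      rwa [show 3 * n - n = 2 * n by omega] at this
    have h1 := hf n
    have h2 := hf (n + 1)
    rw [show 3 * (n + 1) = 3 * n + 1 + 1 + 1 by ring, show 2 * (n + 1) = 2 * n + 1 + 1 by ring] at h2
    simp only [Nat.factorial_succ] at h2
    rw [← h1] at h2
    have hrec : (3 * n + 1 + 1 + 1).choose (n + 1) * ((n + 1) * (2 * n + 2) * (2 * n + 1)) =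
        (3 * n + 3) * (3 * n + 2) * (3 * n + 1) * (3 * n).choose n := by
      have hpos : 0 < n.factorial * (2 * n).factorial := by positivity
      refine Nat.eq_of_mul_eq_mul_right hpos ?_
      linarith
    have hrec' : ((3 * (n + 1)).choose (n + 1) : ℝ) * ((2 * n + 2) * (2 * n + 1)) =
        3 * (3 * n + 2) * (3 * n + 1) * (3 * n).choose n := by
      have : (((3 * n + 1 + 1 + 1).choose (n + 1) * ((n + 1) * (2 * n + 2) * (2 * n + 1)) : ℕ) : ℝ)
        = ((3 * n + 3) * (3 * n + 2) * (3 * n + 1) * (3 * n).choose n : ℕ) := by rw [hrec]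
      push_cast at this
      rw [show 3 * (n + 1) = 3 * n + 1 + 1 + 1 by ring]
      have hn : ((n : ℝ) + 1) ≠ 0 := by positivity
      apply mul_left_cancel₀ hn
      linear_combination this
    set c := ((3 * n).choose n : ℝ)
    set c' := ((3 * (n + 1)).choose (n + 1) : ℝ)
    have hc : 0 ≤ c := by positivity
    have hden : (0 : ℝ) < (2 * n + 2) * (2 * n + 1) := by positivity
    push_cast
    rw [pow_succ]
    refine (mul_le_mul_of_nonneg_right ih (by norm_num)).trans ?_
    rw [← mul_le_mul_iff_of_pos_right hden]
    have e : (3 * ((n : ℝ) + 1) + 1) * c' * ((2 * n + 2) * (2 * n + 1)) =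
        (3 * n + 4) * (3 * (3 * n + 2) * (3 * n + 1) * c) := by rw [← hrec']; ring
    rw [e]
    have : 0 ≤ (3 * (n : ℝ) + 1) * c * (54 * n + 42) / 4 := by positivity
    linarith

/-- The power of exponent `3 n` of the `W`-array contains a unit array of size `(27/4)^(n - o(n))`.
-/
theorem exists_wArr_lower_bound : ∃ C : ℝ, ∀ (K : Type*) [Field K] (n : ℕ), 0 < n →
    ∃ r : ℕ, ArrRestricts (arrPow (wArr K) (3 * n)) (arrUnit K (Fin r)) ∧
      Real.exp (n * Real.log (27 / 4) - C * √n) ≤ r := by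
  -- The last term is the loss in Behrend's bound; the first two absorb the polynomial factor `192 *
  -- n ^ 2`. Nothing depends on `K`.
  refine ⟨Real.log 192 + 4 + 4 * √(Real.log 12), fun K _ n hn => ?_⟩
  obtain ⟨r, hr, hle⟩ := exists_wArr_pow_restricts K n
  refine ⟨r, hr, ?_⟩
  have hn' : (1 : ℝ) ≤ n := by exact_mod_cast hn
  have hsq : (1 : ℝ) ≤ √n := Real.one_le_sqrt.2 hn'
  have hsq0 : 0 < √(n : ℝ) := by linarith
  have hle' : ((3 * n).choose n : ℝ) * (2 * n).choose n * rothNumberNat (3 * 4 ^ n) ≤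
      2 * (6 * 4 ^ n) ^ 2 * r := by exact_mod_cast hle
  have h1 := pow_le_mul_choose_three_mul n
  have h2 : (4 : ℝ) ^ n ≤ 2 * n * (2 * n).choose n := by
    have := Nat.four_pow_le_two_mul_self_mul_centralBinom n hn
    rw [Nat.centralBinom] at this
    exact_mod_cast this
  have h3 := Behrend.roth_lower_bound (N := 3 * 4 ^ n)
  push_cast at h3
  have hlog : √(Real.log (3 * 4 ^ n)) ≤ √(Real.log 12) * √n := by
    rw [← Real.sqrt_mul (Real.log_nonneg (by norm_num))]
    refine Real.sqrt_le_sqrt ?_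
    rw [mul_comm (Real.log 12), ← Real.log_pow]
    refine Real.log_le_log (by positivity) ?_
    rw [show (12 : ℝ) = 3 * 4 by norm_num, mul_pow]
    refine mul_le_mul_of_nonneg_right ?_ (by positivity)
    exact le_self_pow₀ (by norm_num) hn.ne'
  have h4 : 3 * (4 : ℝ) ^ n * Real.exp (-(4 * √(Real.log 12) * √n)) ≤
      rothNumberNat (3 * 4 ^ n) := by
    refine le_trans ?_ h3
    refine mul_le_mul_of_nonneg_left (Real.exp_le_exp.2 ?_) (by positivity)
    linarith
  set e := Real.exp (-(4 * √(Real.log 12) * √n)) with he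
  have he0 : 0 < e := Real.exp_pos _
  have h5 : (27 / 4 : ℝ) ^ n * 4 ^ n * (3 * 4 ^ n * e) ≤
      (3 * n + 1) * (2 * n) * (2 * (6 * 4 ^ n) ^ 2 * r) := by
    calc (27 / 4 : ℝ) ^ n * 4 ^ n * (3 * 4 ^ n * e)
        ≤ ((3 * n + 1) * (3 * n).choose n) * (2 * n * (2 * n).choose n) *
          rothNumberNat (3 * 4 ^ n) := by gcongr
      _ = (3 * n + 1) * (2 * n) * ((3 * n).choose n * (2 * n).choose n *
          rothNumberNat (3 * 4 ^ n)) := by ring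
      _ ≤ _ := by gcongr
  -- The `4 ^ n` from the central binomial and the `4 ^ n` from the Roth number cancel against the
  -- square of the modulus, leaving the growth `27 / 4`.
  have h6 : (27 / 4 : ℝ) ^ n * e ≤ (192 * n ^ 2) * r := by
    have hpos : (0 : ℝ) < 3 * 4 ^ n * 4 ^ n := by positivity
    rw [← mul_le_mul_iff_of_pos_right hpos]
    have hr0 : (0 : ℝ) ≤ r := by positivity
    calc (27 / 4 : ℝ) ^ n * e * (3 * 4 ^ n * 4 ^ n)
        = (27 / 4 : ℝ) ^ n * 4 ^ n * (3 * 4 ^ n * e) := by ring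
      _ ≤ (3 * n + 1) * (2 * n) * (2 * (6 * 4 ^ n) ^ 2 * r) := h5
      _ ≤ (4 * n) * (2 * n) * (2 * (6 * 4 ^ n) ^ 2 * r) := by gcongr; linarith
      _ = 192 * n ^ 2 * r * (3 * 4 ^ n * 4 ^ n) := by ring
  have h7 : (192 * (n : ℝ) ^ 2) ≤ Real.exp ((Real.log 192 + 4) * √n) := by
    rw [add_mul, Real.exp_add]
    refine mul_le_mul ?_ ?_ (by positivity) (Real.exp_pos _).le
    · rw [← Real.log_le_iff_le_exp (by norm_num)]
      have : 0 ≤ Real.log 192 := Real.log_nonneg (by norm_num)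
      nlinarith
    · have : √(n : ℝ) ≤ Real.exp √n := by linarith [Real.add_one_le_exp √(n : ℝ)]
      calc (n : ℝ) ^ 2 = √n ^ 4 := by
            rw [show (4 : ℕ) = 2 * 2 by norm_num, pow_mul, Real.sq_sqrt (by positivity)]
        _ ≤ Real.exp √n ^ 4 := by gcongr
        _ = Real.exp (4 * √n) := by rw [← Real.exp_nat_mul]; norm_num
  have h8 : (27 / 4 : ℝ) ^ n * e ≤ Real.exp ((Real.log 192 + 4) * √n) * r :=
    h6.trans (mul_le_mul_of_nonneg_right h7 (by positivity))
  have h9 : (27 / 4 : ℝ) ^ n = Real.exp (n * Real.log (27 / 4)) := by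
    rw [Real.exp_nat_mul, Real.exp_log (by norm_num)]
  rw [h9, he, ← Real.exp_add] at h8
  rw [← mul_le_mul_iff_of_pos_left (Real.exp_pos ((Real.log 192 + 4) * √n)), ← Real.exp_add]
  refine le_trans (Real.exp_le_exp.2 (le_of_eq ?_)) h8
  ring

end WLower

/-! ### Reading bounds off the limit -/

section Limits

open Filter Topology

variable {Q : ℕ → ℕ} {L : ℝ}

/-- As the limit exists, it may be computed along `d * n + k`; after taking logarithms, `C * √n` and
the shift `k` are negligible against `n`. -/
theorem exp_div_le_of_tendsto (hL : 0 < L)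
    (h : Tendsto (fun N : ℕ => (Q N : ℝ) ^ (1 / (N : ℝ))) atTop (𝓝 L)) {a C : ℝ} {d k : ℕ}
    (hd : 0 < d) (hQ : ∀ n : ℕ, 0 < n → Real.exp (n * a - C * √n) ≤ Q (d * n + k)) :
    Real.exp (a / d) ≤ L := by
  have hsub : Tendsto (fun n : ℕ => d * n + k) atTop atTop :=
    tendsto_atTop_mono (fun n => (Nat.le_mul_of_pos_left n hd).trans (Nat.le_add_right _ _)) tendsto_id
  have h1 := (Real.continuousAt_log hL.ne').tendsto.comp (h.comp hsub)
  rw [← Real.le_log_iff_exp_le hL]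
  have hd' : (d : ℝ) ≠ 0 := by exact_mod_cast hd.ne'
  have hn : Tendsto (fun n : ℕ => (n : ℝ)) atTop atTop := tendsto_natCast_atTop_atTop
  have h2 : Tendsto (fun n : ℕ => (a - C * (√n)⁻¹) / (d + k * (n : ℝ)⁻¹)) atTop
      (𝓝 ((a - C * 0) / (d + k * 0))) := by
    refine Tendsto.div (tendsto_const_nhds.sub (tendsto_const_nhds.mul ?_))
      (tendsto_const_nhds.add (tendsto_const_nhds.mul ?_)) (by simpa using hd')
    · exact tendsto_inv_atTop_zero.comp (Real.tendsto_sqrt_atTop.comp hn)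
    · exact tendsto_inv_atTop_zero.comp hn
  rw [mul_zero, mul_zero, sub_zero, add_zero] at h2
  refine le_of_tendsto_of_tendsto h2 h1 ?_
  filter_upwards [eventually_gt_atTop 0] with n hn0
  have hq := hQ n hn0
  have hqpos : (0 : ℝ) < Q (d * n + k) := (Real.exp_pos _).trans_le hq
  simp only [Function.comp]
  rw [Real.log_rpow hqpos]
  have hn1 : (0 : ℝ) < n := by exact_mod_cast hn0
  have hle : n * a - C * √n ≤ Real.log (Q (d * n + k)) :=
    (Real.le_log_iff_exp_le hqpos).2 hq
  have hs : √(n : ℝ) * √n = n := Real.mul_self_sqrt hn1.le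
  have hs0 : √(n : ℝ) ≠ 0 := (Real.sqrt_pos.2 hn1).ne'
  have e : (a - C * (√(n : ℝ))⁻¹) / (d + k * (n : ℝ)⁻¹) =
      (n * a - C * √n) / (d * n + k) := by
    have h3 : (n : ℝ) * (√(n : ℝ))⁻¹ = √n := by
      rw [← div_eq_mul_inv, div_eq_iff hs0, hs]
    rw [← mul_div_mul_left _ _ hn1.ne']
    congr 1
    · linear_combination - C * h3
    · field_simp
  rw [e]
  push_cast
  rw [one_div, inv_mul_eq_div]
  exact div_le_div_of_nonneg_right hle (by positivity)

theorem le_of_tendsto_of_le_mul_pow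
    (h : Tendsto (fun N : ℕ => (Q N : ℝ) ^ (1 / (N : ℝ))) atTop (𝓝 L)) {b c : ℝ} (hb : 0 < b)
    (hc : 0 < c) (hQ : ∀ N, (Q N : ℝ) ≤ b * c ^ N) : L ≤ c := by
  have h1 : Tendsto (fun N : ℕ => b ^ (1 / (N : ℝ)) * c) atTop (𝓝 (b ^ (0 : ℝ) * c)) := by
    refine Tendsto.mul_const c ?_
    exact ((Real.continuous_const_rpow hb.ne').tendsto 0).comp tendsto_one_div_atTop_nhds_zero_nat
  rw [Real.rpow_zero, one_mul] at h1
  refine le_of_tendsto_of_tendsto h h1 ?_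
  filter_upwards [eventually_gt_atTop 0] with N hN
  have hN' : (N : ℝ) ≠ 0 := by exact_mod_cast hN.ne'
  calc (Q N : ℝ) ^ (1 / (N : ℝ)) ≤ (b * c ^ N) ^ (1 / (N : ℝ)) :=
        Real.rpow_le_rpow (by positivity) (hQ N) (by positivity)
    _ = b ^ (1 / (N : ℝ)) * c := by
        rw [Real.mul_rpow hb.le (by positivity), ← Real.rpow_natCast, ← Real.rpow_mul hc.le,
          mul_one_div_cancel hN', Real.rpow_one]

end Limits

/-! ### Arrays that split off a leg -/

section RankOne

variable {K : Type*} [Field K]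

theorem le_one_of_separable {r : ℕ} {a : Fin r → K} {G : Fin r → K} (h1 : ∀ p, a p * G p = 1)
    (h0 : ∀ p q, p ≠ q → a p * G q = 0) : r ≤ 1 := by
  by_contra! hr
  have e := h0 ⟨0, by omega⟩ ⟨1, hr⟩ (by simp)
  rcases mul_eq_zero.1 e with e | e
  · simpa [e] using h1 ⟨0, by omega⟩
  · simpa [e] using h1 ⟨1, hr⟩

variable {α β γ : Type*} [Fintype α] [Fintype β] [Fintype γ] {t : α → β → γ → K}

/-- Splitting off a leg survives powers and restrictions, but a unit array with two entries on its
diagonal does not split this way. -/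
theorem le_one_of_arrPow_restricts
    (ht : (∃ (l : α → K) (S : β → γ → K), ∀ x y z, t x y z = l x * S y z) ∨
      (∃ (l : β → K) (S : α → γ → K), ∀ x y z, t x y z = l y * S x z) ∨
      (∃ (l : γ → K) (S : α → β → K), ∀ x y z, t x y z = l z * S x y)) {N r : ℕ}
    (h : ArrRestricts (arrPow t N) (arrUnit K (Fin r))) : r ≤ 1 := by
  obtain ⟨A, B, C, h⟩ := h
  rcases ht with ⟨l, S, ht⟩ | ⟨l, S, ht⟩ | ⟨l, S, ht⟩
  · have key : ∀ p q s, arrUnit K (Fin r) p q s = (∑ x, A p x * ∏ t, l (x t)) *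
        (∑ y, ∑ z, B q y * C s z * ∏ t, S (y t) (z t)) := by
      intro p q s
      rw [h, Finset.sum_mul]
      refine Finset.sum_congr rfl fun x _ => ?_
      rw [Finset.mul_sum]
      refine Finset.sum_congr rfl fun y _ => ?_
      rw [Finset.mul_sum]
      refine Finset.sum_congr rfl fun z _ => ?_
      simp only [arrPow, ht, Finset.prod_mul_distrib]
      ring
    refine le_one_of_separable (fun p => (key p p p).symm.trans (by simp [arrUnit]))
      fun p q hpq => (key p q q).symm.trans (by simp [arrUnit, hpq])
  · have key : ∀ p q s, arrUnit K (Fin r) p q s = (∑ y, B q y * ∏ t, l (y t)) *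
        (∑ x, ∑ z, A p x * C s z * ∏ t, S (x t) (z t)) := by
      intro p q s
      rw [h, Finset.sum_comm, Finset.sum_mul]
      refine Finset.sum_congr rfl fun y _ => ?_
      rw [Finset.mul_sum]
      refine Finset.sum_congr rfl fun x _ => ?_
      rw [Finset.mul_sum]
      refine Finset.sum_congr rfl fun z _ => ?_
      simp only [arrPow, ht, Finset.prod_mul_distrib]
      ring
    refine le_one_of_separable (fun p => (key p p p).symm.trans (by simp [arrUnit]))
      fun p q hpq => (key q p q).symm.trans (by simp [arrUnit, hpq])
  · have key : ∀ p q s, arrUnit K (Fin r) p q s = (∑ z, C s z * ∏ t, l (z t)) *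
        (∑ x, ∑ y, A p x * B q y * ∏ t, S (x t) (y t)) := by
      intro p q s
      rw [h, Finset.sum_mul]
      refine ((Finset.sum_congr rfl fun x _ => Finset.sum_comm).trans Finset.sum_comm).trans ?_
      refine Finset.sum_congr rfl fun z _ => ?_
      rw [Finset.mul_sum]
      refine Finset.sum_congr rfl fun x _ => ?_
      rw [Finset.mul_sum]
      refine Finset.sum_congr rfl fun y _ => ?_
      simp only [arrPow, ht, Finset.prod_mul_distrib]
      ring
    refine le_one_of_separable (fun p => (key p p p).symm.trans (by simp [arrUnit]))
      fun p q hpq => (key q q p).symm.trans (by simp [arrUnit, Ne.symm hpq])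

end RankOne

/-! ### The constant `c₃` -/

section Constant

theorem exp_log_div_three : Real.exp (Real.log (27 / 4) / 3) = 3 / (2 : ℝ) ^ ((2 : ℝ) / 3) := by
  have h : (27 / 4 : ℝ) = (3 / (2 : ℝ) ^ ((2 : ℝ) / 3)) ^ 3 := by
    rw [div_pow, ← Real.rpow_mul_natCast (by norm_num)]
    norm_num
  rw [h, Real.log_pow, Nat.cast_ofNat, mul_div_cancel_left₀ _ (by norm_num),
    Real.exp_log (by positivity)]

theorem one_lt_three_div : 1 < 3 / (2 : ℝ) ^ ((2 : ℝ) / 3) := by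
  rw [← exp_log_div_three, Real.one_lt_exp_iff]
  exact div_pos (Real.log_pos (by norm_num)) (by norm_num)

theorem three_div_lt_two : 3 / (2 : ℝ) ^ ((2 : ℝ) / 3) < 2 := by
  rw [← exp_log_div_three]
  calc Real.exp (Real.log (27 / 4) / 3) < Real.exp (Real.log 2) := by
        refine Real.exp_lt_exp.2 ?_
        have : Real.log (27 / 4) < Real.log (2 ^ 3) := Real.log_lt_log (by norm_num) (by norm_num)
        rw [Real.log_pow] at this
        push_cast at this
        linarith
    _ = 2 := Real.exp_log (by norm_num)

end Constant

/-! ### The trichotomy for the limit -/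

namespace Tensor3

open Filter Topology

variable {K : Type*} [Field K] {n₁ n₂ n₃ : ℕ} {T : Tensor3 K n₁ n₂ n₃} {L : ℝ}

theorem limit_eq_one (hT : T ≠ 0)
    (h : Tendsto (fun N : ℕ => (subrank (kronPow T N) : ℝ) ^ (1 / (N : ℝ))) atTop (𝓝 L))
    (hQ : ∀ N, subrank (kronPow T N) ≤ 1) : L = 1 := by
  refine tendsto_nhds_unique h (tendsto_const_nhds.congr fun N => ?_)
  rw [le_antisymm (hQ N) (one_le_subrank_kronPow hT N)]
  simp

theorem two_le_limit (hL : 0 < L)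
    (h : Tendsto (fun N : ℕ => (subrank (kronPow T N) : ℝ) ^ (1 / (N : ℝ))) atTop (𝓝 L))
    {k : ℕ} (hQ : ∀ n, ArrRestricts (arrPow (arr T) (n + k)) (arrUnit K (Fin (2 ^ n)))) :
    2 ≤ L := by
  have := exp_div_le_of_tendsto (a := Real.log 2) (C := 0) (d := 1) (k := k) hL h one_pos
    fun n _ => by
      rw [zero_mul, sub_zero, Real.exp_nat_mul, Real.exp_log (by norm_num), one_mul]
      exact_mod_cast (le_subrank_iff T (2 ^ n) (n + k)).2 (hQ n)
  simpa [Real.exp_log] using this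

theorem arrPow_restricts_unit_pow {α β γ : Type*} [Fintype α] [Fintype β] [Fintype γ]
    {t : α → β → γ → K} (h : ArrRestricts t (arrUnit K (Fin 2))) (n : ℕ) :
    ArrRestricts (arrPow t n) (arrUnit K (Fin (2 ^ n))) := by
  refine (h.pow n).trans ?_
  rw [arrPow_arrUnit]
  exact arrUnit_restricts_of_card_le (by simp)

theorem limit_trichotomy (hT : T ≠ 0) (hL : 0 < L)
    (h : Tendsto (fun N : ℕ => (subrank (kronPow T N) : ℝ) ^ (1 / (N : ℝ))) atTop (𝓝 L)) :
    L = 1 ∨ L = 3 / (2 : ℝ) ^ ((2 : ℝ) / 3) ∨ 2 ≤ L := by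
  rcases array_trichotomy (arr T) with h1 | h1 | ⟨m, hm, hTm, hmT⟩
  · left
    exact limit_eq_one hT h fun N =>
      le_one_of_arrPow_restricts h1 ((le_subrank_iff T _ N).1 le_rfl)
  · right; right
    exact two_le_limit (k := 0) hL h fun n => arrPow_restricts_unit_pow h1 n
  · right
    -- The square of the pencil supplies the unit array over `K` that pays for descent from `E`.
    let E := m.charpoly.SplittingField
    obtain ⟨k, hk⟩ := exists_shift_of_baseChange (E := E)
      ((ArrRestricts.pow hTm 2).trans (pencil_sq_restricts_unit hm))
    rcases exists_extension_dichotomy hm with h2 | ⟨h2, h3⟩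
    · right
      exact two_le_limit (k := k) hL h fun n => hk _ _
        (arrPow_restricts_unit_pow (hTm.baseChange.trans h2) n)
    · left
      have hTW : ArrRestricts (arrBaseChange E (arr T)) (wArr E) := hTm.baseChange.trans h2
      have hWT : ArrRestricts (wArr E) (arrBaseChange E (arr T)) := h3.trans hmT.baseChange
      apply le_antisymm
      -- Restrictions over `K` persist over `E`, so the upper bound for `W` needs no descent; only
      -- the lower bound uses the shift `k`.
      · refine le_of_tendsto_of_le_mul_pow h (b := 3) (by norm_num) (by positivity) fun N => ?_
        refine le_of_wArr_pow_restricts (K := E) ((hWT.pow N).trans ?_)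
        rw [← arrBaseChange_arrPow, ← arrBaseChange_arrUnit (K := K)]
        exact ((le_subrank_iff T _ N).1 le_rfl).baseChange
      · obtain ⟨C, hC⟩ := exists_wArr_lower_bound
        rw [← exp_log_div_three]
        refine exp_div_le_of_tendsto (d := 3) (k := k) (C := C) hL h (by norm_num) fun n hn => ?_
        obtain ⟨r, hr, hle⟩ := hC E n hn
        refine hle.trans ?_
        exact_mod_cast (le_subrank_iff T r _).2 (hk _ _ ((hTW.pow _).trans hr))

end Tensor3

theorem mainTheorem6 {K : Type*} [Field K] (n₁ n₂ n₃ : ℕ) (T : Tensor3 K n₁ n₂ n₃) (hT : T ≠ 0) :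
    -- the limit defining the asymptotic subrank exists
    Filter.Tendsto (fun N : ℕ => (Tensor3.subrank (Tensor3.kronPow T N) : ℝ) ^ (1 / (N : ℝ)))
      Filter.atTop (nhds (Tensor3.asymptoticSubrank T)) ∧
    -- at least one of the three cases holds
    (Tensor3.asymptoticSubrank T = 1 ∨
      Tensor3.asymptoticSubrank T = 3 / (2 : ℝ) ^ ((2 : ℝ) / 3) ∨
      2 ≤ Tensor3.asymptoticSubrank T) ∧
    -- no two of the three cases hold together
    ¬(Tensor3.asymptoticSubrank T = 1 ∧
      Tensor3.asymptoticSubrank T = 3 / (2 : ℝ) ^ ((2 : ℝ) / 3)) ∧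
    ¬(Tensor3.asymptoticSubrank T = 1 ∧ 2 ≤ Tensor3.asymptoticSubrank T) ∧
    ¬(Tensor3.asymptoticSubrank T = 3 / (2 : ℝ) ^ ((2 : ℝ) / 3) ∧
      2 ≤ Tensor3.asymptoticSubrank T) := by
  obtain ⟨L, hL, h⟩ := Tensor3.exists_tendsto_subrank hT
  have hlim : Tensor3.asymptoticSubrank T = L := h.limUnder_eq
  have h1 := one_lt_three_div
  have h2 := three_div_lt_two
  rw [hlim]
  refine ⟨h, Tensor3.limit_trichotomy hT hL h, ?_, ?_, ?_⟩
  · rintro ⟨e1, e2⟩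
    linarith
  · rintro ⟨e1, e2⟩
    linarith
  · rintro ⟨e1, e2⟩
    linarith
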